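/- Conventions. All operators are bounded and linear, all Hilbert spaces are complex, and $\mathbb{R}_+=[0,\infty)$. For an operator $T$ put $\mathscr{B}_2(T)=I-2T^*T+T^{*2}T^2$. $T$ is conditionally positive definite (CPD) if for every vector $h$ the sequence $\gamma_n=\|T^nh\|^2$ satisfies $\sum_{i,j=0}^k\gamma_{i+j}c_i\bar c_j\ge 0$ for all $k\ge 0$ and all $c_0,\dots,c_k\in\mathbb{C}$ with $c_0+\dots+c_k=0$. $T$ is subnormal if it is the restriction of a normal operator on a larger Hilbert space. An operator is quasi-invertible if it is injective and has dense range. For a bounded sequence $\lambda=\{\lambda_n\}_{n\ge 0}\subseteq(0,\infty)$, $W_\lambda$ is the operator on $\ell^2$ with $W_\lambda e_n=\lambda_ne_{n+1}$ for all $n\ge 0$ (a unilateral weighted shift), and $\hat\lambda_n=\lambda_0^2\cdots\lambda_{n-1}^2$, $\hat\lambda_0=1$. If $W_\lambda$ is subnormal, its Berger measure is the unique compactly supported Borel probability measure $\mu$ on $\mathbb{R}_+$ with $\hat\lambda_n=\int x^n\,d\mu(x)$ for all $n\ge 0$. If $W_\lambda$ is CPD, its scalar representing triplet is the unique triplet $(b,c,\nu)$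 consisting of $b\in\mathbb{R}$, $c\ge 0$ and a compactly supported finite Borel measure $\nu$ on $\mathbb{R}_+$ with $\nu(\{1\})=0$, such that $\hat\lambda_n=1+bn+cn^2+\int Q_n\,d\nu$ for all $n\ge 0$, where $Q_0=Q_1=0$ and $Q_n(x)=\sum_{j=0}^{n-2}(n-j-1)x^j$ for $n\ge 2$. $W_\lambda$ is of type I if $\nu=0$ and $c=0$, and of type III if $\operatorname{supp}\nu\not\subseteq\{0\}$ or $c\ne 0$. For a compactly supported finite Borel measure $\rho$ on $\mathbb{C}$, $H^2(\rho)$ is the closure in $L^2(\rho)$ of the complex polynomials in $z$, and $M_z$ is the operator of multiplication by $z$ on $H^2(\rho)$. $\rho$ is rotation-invariant if $\rho(e^{i\varphi}\Delta)=\rho(\Delta)$ for all Borel sets $\Delta\subseteq\mathbb{C}$ and all $\varphi\in[0,2\pi)$. Theorem 1.2. Let $W_\lambda$ be a CPD unilateral weighted shift with weights $\lambda=\{\lambda_n\}_{n=0}^\infty$ that is not of type I. Then there exist a nonzero, compactly supported, finite, rotation-invariant Borel measure $\rho$ on $\mathbb{C}$ and an operator $X\colon\ell^2\to H^2(\rho)$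 with dense range such that (i) $XW_\lambda=M_zX$; (ii) $X^*X=\mathscr{B}_2(W_\lambda)$; (iii) $X$ is quasi-invertible if and only if $W_\lambda$ is of type III; (iv) if $W_\lambda$ is of type III, then $M_z$ on $H^2(\rho)$ is unitarily equivalent to a subnormal unilateral weighted shift with Berger measure $\frac{1}{\rho(\mathbb{C})}\rho\circ\phi^{-1}$, where $\phi(z)=|z|^2$ and $(\rho\circ\phi^{-1})(\Delta)=\rho(\phi^{-1}(\Delta))$ for Borel sets $\Delta\subseteq\mathbb{R}_+$; (v) $X$ has a bounded inverse if and only if there exists $\varepsilon>0$ such that $\mathscr{B}_2(W_\lambda)\ge\varepsilon I$; for every $\varepsilon>0$, the latter inequality is equivalent to $\beta_n:=1-2\lambda_n^2+\lambda_n^2\lambda_{n+1}^2\ge\varepsilon$ for all $n\ge 0$. If $X$ has a bounded inverse, then $W_\lambda$ is of type III and is similar to a subnormal unilateral weighted shift with Berger measure $\frac{1}{\rho(\mathbb{C})}\rho\circ\phi^{-1}$. -/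

import Mathlib

open MeasureTheory
open scoped NNReal ENNReal

noncomputable section

namespace CPDShift

open Polynomial
open scoped ComplexOrder

universe u v

/-! ### Operators on complex Hilbert spaces -/

section Operators

variable {H : Type u} [NormedAddCommGroup H] [InnerProductSpace ℂ H]
variable {K : Type v} [NormedAddCommGroup K] [InnerProductSpace ℂ K]

/-- The operator `∑_{k=0}^m (-1)^k (m choose k) T*^k T^k`. -/
def bscr [CompleteSpace H] (m : ℕ) (T : H →L[ℂ] H) : H →L[ℂ] H :=
  ∑ k ∈ Finset.range (m + 1),
    ((-1 : ℂ) ^ k * (m.choose k : ℂ)) • (ContinuousLinearMap.adjoint T ^ k * T ^ k)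

/-- A real sequence `γ` is conditionally positive definite if
`∑_{i,j=0}^k γ_{i+j} c_i conj(c_j) ≥ 0` for all complex `c_0, …, c_k` with zero sum. -/
def IsCPDSeq (γ : ℕ → ℝ) : Prop :=
  ∀ (k : ℕ) (c : ℕ → ℂ), ∑ j ∈ Finset.range (k + 1), c j = 0 →
    0 ≤ ∑ i ∈ Finset.range (k + 1), ∑ j ∈ Finset.range (k + 1),
      (γ (i + j) : ℂ) * c i * (starRingEnd ℂ) (c j)

/-- `T` is conditionally positive definite if `n ↦ ‖T^n h‖²` is so for every vector `h`. -/
def IsCPD (T : H →L[ℂ] H) : Prop :=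
  ∀ h : H, IsCPDSeq fun n => ‖(T ^ n) h‖ ^ 2

/-- `T` is subnormal if it is the restriction of a normal operator on a larger Hilbert space. -/
def IsSubnormal (T : H →L[ℂ] H) : Prop :=
  ∃ (L : Type u) (_ : NormedAddCommGroup L) (_ : InnerProductSpace ℂ L) (_ : CompleteSpace L)
    (V : H →ₗᵢ[ℂ] L) (N : L →L[ℂ] L), IsStarNormal N ∧ ∀ h, V (T h) = N (V h)

/-- Injective with dense range. -/
def QuasiInvertible (X : H →L[ℂ] K) : Prop :=
  Function.Injective X ∧ DenseRange X

/-- `X` is invertible, with a bounded (everywhere defined) inverse. -/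
def HasBoundedInverse (X : H →L[ℂ] K) : Prop :=
  ∃ Y : K →L[ℂ] H, Y ∘L X = ContinuousLinearMap.id ℂ H ∧ X ∘L Y = ContinuousLinearMap.id ℂ K

/-- `A` and `B` are unitarily equivalent. -/
def UnitarilyEquivalent (A : H →L[ℂ] H) (B : K →L[ℂ] K) : Prop :=
  ∃ U : H ≃ₗᵢ[ℂ] K, ∀ h, U (A h) = B (U h)

/-- `A` and `B` are similar. -/
def IsSimilar (A : H →L[ℂ] H) (B : K →L[ℂ] K) : Prop :=
  ∃ X : H →L[ℂ] K, Function.Bijective X ∧ X ∘L A = B ∘L X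

end Operators

/-! ### Unilateral weighted shifts -/

/-- The Hilbert space of square summable complex sequences. -/
abbrev Ell2 : Type := lp (fun _ : ℕ => ℂ) 2

/-- The vector `e_n` of the standard orthonormal basis of `ℓ²`. -/
def e (n : ℕ) : Ell2 := lp.single 2 n 1

/-- Bounded sequences of positive weights. -/
structure Weights where
  /-- the weights -/
  w : ℕ → ℝ
  pos : ∀ n, 0 < w n
  bdd : BddAbove (Set.range w)

namespace Weights

variable (l : Weights)

/-- The sequence `(0, w_0 x_0, w_1 x_1, …)`. -/
def shiftFun (x : ℕ → ℂ) : ℕ → ℂ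
  | 0 => 0
  | n + 1 => (l.w n : ℂ) * x n

lemma exists_bound : ∃ C : ℝ, 0 ≤ C ∧ ∀ n, l.w n ≤ C := by
  obtain ⟨C, hC⟩ := l.bdd
  have h : ∀ n, l.w n ≤ C := fun n => hC ⟨n, rfl⟩
  exact ⟨C, (l.pos 0).le.trans (h 0), h⟩

lemma shiftFun_sq_le {C : ℝ} (hC : ∀ n, l.w n ≤ C) (x : ℕ → ℂ) (n : ℕ) :
    ‖l.shiftFun x (n + 1)‖ ^ 2 ≤ C ^ 2 * ‖x n‖ ^ 2 := by
  have h1 : ‖l.shiftFun x (n + 1)‖ = l.w n * ‖x n‖ := by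
    simp [shiftFun, abs_of_pos (l.pos n)]
  rw [h1, mul_pow]
  have := (l.pos n).le
  have := hC n
  gcongr

lemma summable_sq (x : Ell2) : Summable fun n => ‖x n‖ ^ 2 := by
  have h := (memℓp_gen_iff (p := 2) (by norm_num)).1 (lp.memℓp x)
  simpa using h

lemma summable_shiftFun (x : Ell2) : Summable fun n => ‖l.shiftFun x n‖ ^ 2 := by
  obtain ⟨C, -, hC⟩ := l.exists_bound
  refine (summable_nat_add_iff 1).1 ?_
  exact Summable.of_nonneg_of_le (fun _ => by positivity) (fun n => l.shiftFun_sq_le hC x n)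
    ((summable_sq x).mul_left _)

lemma memℓp_shiftFun (x : Ell2) : Memℓp (l.shiftFun x) 2 :=
  (memℓp_gen_iff (p := 2) (by norm_num)).2 (by simpa using l.summable_shiftFun x)

/-- The weighted shift as a linear map. -/
def shiftₗ : Ell2 →ₗ[ℂ] Ell2 where
  toFun x := ⟨l.shiftFun x, l.memℓp_shiftFun x⟩
  map_add' x y := by
    ext n
    change l.shiftFun (⇑x + ⇑y) n = l.shiftFun x n + l.shiftFun y n
    cases n with
    | zero => simp [shiftFun]
    | succ n => simp [shiftFun, mul_add]
  map_smul' c x := by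
    ext n
    change l.shiftFun (c • ⇑x) n = c * l.shiftFun x n
    cases n with
    | zero => simp [shiftFun]
    | succ n => simp [shiftFun, mul_left_comm]

lemma exists_shift_bound : ∃ C : ℝ, ∀ x : Ell2, ‖l.shiftₗ x‖ ≤ C * ‖x‖ := by
  obtain ⟨C, hC0, hC⟩ := l.exists_bound
  refine ⟨C, fun x => ?_⟩
  refine lp.norm_le_of_tsum_le (p := 2) (by norm_num) (by positivity) ?_
  have hx := lp.norm_rpow_eq_tsum (p := 2) (by norm_num) x
  simp only [ENNReal.toReal_ofNat, Real.rpow_ofNat] at hx ⊢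
  rw [mul_pow, hx, ← tsum_mul_left]
  change ∑' n, ‖l.shiftFun x n‖ ^ 2 ≤ _
  rw [(l.summable_shiftFun x).tsum_eq_zero_add]
  simp only [shiftFun, norm_zero, ne_eq, OfNat.ofNat_ne_zero, not_false_eq_true, zero_pow, zero_add]
  exact ((summable_nat_add_iff 1).2 (l.summable_shiftFun x)).tsum_le_tsum
    (fun n => l.shiftFun_sq_le hC x n) ((summable_sq x).mul_left _)

/-- The unilateral weighted shift `W_λ ∈ B(ℓ²)`. -/
def shift : Ell2 →L[ℂ] Ell2 :=
  l.shiftₗ.mkContinuousOfExistsBound l.exists_shift_bound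

/-- The defining property: `W_λ e_n = λ_n e_{n+1}`. -/
lemma shift_e (n : ℕ) : l.shift (e n) = (l.w n : ℂ) • e (n + 1) := by
  ext k
  change l.shiftFun (e n) k = (l.w n : ℂ) * e (n + 1) k
  cases k with
  | zero => simp [shiftFun, e, lp.single_apply]
  | succ k =>
    by_cases h : k = n
    · subst h
      simp [shiftFun, e]
    · simp [shiftFun, e, lp.single_apply, h]

/-- The formal moment sequence `λ̂_n = λ_0² ⋯ λ_{n-1}²`. -/
def moment (n : ℕ) : ℝ := ∏ i ∈ Finset.range n, l.w i ^ 2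

/-- `β_n = 1 - 2 λ_n² + λ_n² λ_{n+1}²`. -/
def beta (n : ℕ) : ℝ := 1 - 2 * l.w n ^ 2 + l.w n ^ 2 * l.w (n + 1) ^ 2

end Weights

/-- The polynomial `Q_n(x) = ∑_{j=0}^{n-2} (n-j-1) x^j`, with `Q_0 = Q_1 = 0`. -/
def Q (n : ℕ) (x : ℝ) : ℝ :=
  ∑ j ∈ Finset.range (n - 1), ((n : ℝ) - j - 1) * x ^ j

/-- `(b, c, ν)` is the scalar representing triplet of the weighted shift with weights `l`. -/
structure IsScalarTriplet (l : Weights) (b c : ℝ) (ν : Measure ℝ≥0) : Prop where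
  c_nonneg : 0 ≤ c
  finite : IsFiniteMeasure ν
  compact : IsCompact ν.support
  one : ν {1} = 0
  moment_eq : ∀ n : ℕ, l.moment n = 1 + b * n + c * (n : ℝ) ^ 2 + ∫ x : ℝ≥0, Q n (x : ℝ) ∂ν

/-- Type I (for a CPD shift, whose scalar representing triplet exists and is unique). -/
def IsTypeI (l : Weights) : Prop :=
  ∃ (b c : ℝ) (ν : Measure ℝ≥0), IsScalarTriplet l b c ν ∧ ν = 0 ∧ c = 0

/-- Type III (for a CPD shift, whose scalar representing triplet exists and is unique). -/
def IsTypeIII (l : Weights) : Prop :=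
  ∃ (b c : ℝ) (ν : Measure ℝ≥0), IsScalarTriplet l b c ν ∧ (¬ ν.support ⊆ {0} ∨ c ≠ 0)

/-- The weighted shift with weights `l` is subnormal and has Berger measure `μ`. -/
structure IsSubnormalWithBerger (l : Weights) (μ : Measure ℝ≥0) : Prop where
  subnormal : IsSubnormal l.shift
  prob : IsProbabilityMeasure μ
  compact : IsCompact μ.support
  moment_eq : ∀ n : ℕ, l.moment n = ∫ x : ℝ≥0, (x : ℝ) ^ n ∂μ

/-! ### Measures on the plane and the space `H²(ρ)` -/

/-- `ρ(e^{iφ} Δ) = ρ(Δ)` for all Borel sets `Δ` and all angles `φ`. -/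
def RotationInvariant (ρ : Measure ℂ) : Prop :=
  ∀ φ ∈ Set.Ico (0 : ℝ) (2 * Real.pi), ∀ Δ : Set ℂ, MeasurableSet Δ →
    ρ ((fun z => Complex.exp (Complex.I * φ) * z) '' Δ) = ρ Δ

/-- The measure `ρ(ℂ)⁻¹ ρ ∘ φ⁻¹` on `[0, ∞)`, where `φ(z) = |z|²`. -/
def radialMeasure (ρ : Measure ℂ) : Measure ℝ≥0 :=
  (ρ Set.univ)⁻¹ • ρ.map (fun z => ‖z‖₊ ^ 2)

/-- The elements of `L²(ρ)` given by complex polynomials. -/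
def polySubspace (ρ : Measure ℂ) : Submodule ℂ (Lp ℂ 2 ρ) where
  carrier := {f | ∃ p : ℂ[X], f =ᵐ[ρ] fun z => p.eval z}
  zero_mem' := ⟨0, by
    filter_upwards [Lp.coeFn_zero ℂ 2 ρ] with z hz
    simpa using hz⟩
  add_mem' := by
    rintro f g ⟨p, hp⟩ ⟨q, hq⟩
    refine ⟨p + q, ?_⟩
    filter_upwards [Lp.coeFn_add f g, hp, hq] with z h1 h2 h3
    rw [h1, Pi.add_apply, h2, h3, eval_add]
  smul_mem' := by
    rintro c f ⟨p, hp⟩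
    refine ⟨c • p, ?_⟩
    filter_upwards [Lp.coeFn_smul c f, hp] with z h1 h2
    rw [h1, Pi.smul_apply, h2, eval_smul]

/-- `H²(ρ)`: the closure of the polynomials in `L²(ρ)`. -/
abbrev H2 (ρ : Measure ℂ) : Submodule ℂ (Lp ℂ 2 ρ) :=
  (polySubspace ρ).topologicalClosure

section Mz

variable {ρ : Measure ℂ}

lemma memLp_id (hρ : IsCompact ρ.support) : MemLp (fun z : ℂ => z) ∞ ρ := by
  obtain ⟨C, hC⟩ := hρ.isBounded.exists_norm_le
  refine memLp_top_of_bound aestronglyMeasurable_id C ?_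
  filter_upwards [Measure.support_mem_ae (μ := ρ)] with z hz using hC z hz

/-- Multiplication by the independent variable on `L²(ρ)`, for `ρ` compactly supported. -/
def mulZ (hρ : IsCompact ρ.support) : Lp ℂ 2 ρ →L[ℂ] Lp ℂ 2 ρ :=
  (ContinuousLinearMap.mul ℂ ℂ).holderL ρ ∞ 2 2 ((memLp_id hρ).toLp)

lemma mulZ_ae (hρ : IsCompact ρ.support) (f : Lp ℂ 2 ρ) : mulZ hρ f =ᵐ[ρ] fun z => z * f z := by
  filter_upwards [(ContinuousLinearMap.mul ℂ ℂ).coeFn_holder (r := 2) ((memLp_id hρ).toLp) f,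
    (memLp_id hρ).coeFn_toLp] with z h1 h2
  rw [h2] at h1
  simpa [mulZ] using h1

lemma mulZ_mem (hρ : IsCompact ρ.support) (f : Lp ℂ 2 ρ) (hf : f ∈ H2 ρ) : mulZ hρ f ∈ H2 ρ := by
  have hp : Set.MapsTo (mulZ hρ) (polySubspace ρ) (polySubspace ρ) := by
    rintro f ⟨p, hp⟩
    refine ⟨X * p, ?_⟩
    filter_upwards [mulZ_ae hρ f, hp] with z h1 h2
    simp [h1, h2]
  exact hp.closure (mulZ hρ).continuous hf

/-- The operator `M_z` of multiplication by the independent variable on `H²(ρ)`. -/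
def Mz (hρ : IsCompact ρ.support) : H2 ρ →L[ℂ] H2 ρ :=
  ((mulZ hρ).comp (H2 ρ).subtypeL).codRestrict (H2 ρ) fun f => mulZ_mem hρ f f.2

/-- `(M_z f)(w) = w f(w)` for `ρ`-almost every `w`. -/
lemma Mz_ae (hρ : IsCompact ρ.support) (f : H2 ρ) :
    (Mz hρ f : Lp ℂ 2 ρ) =ᵐ[ρ] fun w => w * (f : Lp ℂ 2 ρ) w :=
  mulZ_ae hρ f

end Mz

end CPDShift

end

open CPDShift

/-!
The second differences of the moments `γ n = ‖W ^ n e₀‖ ^ 2` of the shift `W` are the numbers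
`γ n * β n`, where `β n` are the diagonal entries of `I - 2W*W + W*²W²`, and everything follows once
these are known to be the moments of a measure `σ` on some `[0, R]`.

Conditional positive definiteness of `n ↦ ‖W ^ n e₀‖ ^ 2` and of `n ↦ ‖W ^ n W e₀‖ ^ 2`, applied to
the coefficients of the multiples of `X - 1`, says that the functional `X ^ n ↦ γ n * β n` is
nonnegative on squares and on `X` times squares (`IsCPDSeq.secondDiff_nonneg`). A log-convex sequence
of at most geometric growth has its ratios bounded by the growth rate, so the functional is also
nonnegative on all `X ^ k * (R - X) ^ m` (`hausdorff_nonneg`). Hausdorff's moment theorem then yields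
`σ`; here it is proved with Bernstein's discrete measures and the compactness of the set of measures
of bounded mass on `[0, R]` (`exists_measure_of_hausdorff_nonneg`).

The measure `ρ` is the rotation-invariant measure with image `σ` under `z ↦ ‖z‖ ^ 2`. Rotation
invariance makes the monomials orthogonal in `H²(ρ)`, and `‖z ^ n‖ ^ 2 = γ n * β n`. Hence
`X e n = z ^ n / √(γ n)` defines an operator that intertwines `W` with `M_z` and has `X*X` equal to
the diagonal operator with entries `β n` (`exists_intertwiner`). Injectivity of `X` means `β n > 0`
for all `n`, and bounded invertibility means that `β` is bounded away from zero. When all `β n` are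
positive, the normalised monomials form an orthonormal basis of `H²(ρ)` in which `M_z` is a weighted
shift (`exists_weightedShift`); it is subnormal as a restriction of multiplication by `z` on `L²(ρ)`.

Finally, a scalar representing triplet `(b, c, ν)` satisfies `γ n * β n = 2 * c + ∫ x ^ n ∂ν`. So it
can be read off from `σ`, the shift is of type I when `σ = 0`, and it is of type III exactly when all
`β n` are positive (`beta_pos_of_isTypeIII`, `isTypeIII_of_beta_pos`).
-/

noncomputable section

namespace CPDShift

open Polynomial Filter Topology
open scoped ComplexOrder

/-! ### The moment problem on a compact interval -/

/-- A log-convex sequence of nonnegative numbers that grows at most like `R ^ n` has first ratio at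
most `R`, because its successive ratios increase. -/
lemma le_mul_of_logConvex {a : ℕ → ℝ} {R C : ℝ} (hR : 0 < R) (h0 : ∀ n, 0 ≤ a n)
    (hlog : ∀ n, a (n + 1) ^ 2 ≤ a n * a (n + 2)) (hC : ∀ n, a n ≤ C * R ^ n) :
    a 1 ≤ R * a 0 := by
  by_contra! hlt
  have ha0 : 0 < a 0 := by
    refine (h0 0).lt_of_ne fun h => ?_
    have h1 := hlog 0
    rw [← h] at h1 hlt
    nlinarith
  set s := a 1 / a 0 with hs
  have hsR : R < s := by rw [hs, lt_div_iff₀ ha0]; exact hlt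
  have hs0 : 0 < s := hR.trans hsR
  have key : ∀ n, 0 < a n ∧ s * a n ≤ a (n + 1) := by
    intro n
    induction n with
    | zero => exact ⟨ha0, by rw [hs, div_mul_cancel₀ _ ha0.ne']⟩
    | succ n ih =>
      have hpos : 0 < a (n + 1) := (mul_pos hs0 ih.1).trans_le ih.2
      refine ⟨hpos, ?_⟩
      have h1 := hlog n
      have h2 : s * a n * a (n + 1) ≤ a (n + 1) * a (n + 1) := by gcongr; exact ih.2
      have h3 : a n * (s * a (n + 1)) ≤ a n * a (n + 2) := by nlinarith
      exact le_of_mul_le_mul_left h3 ih.1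
  have hpow : ∀ n, a 0 * s ^ n ≤ a n := by
    intro n
    induction n with
    | zero => simp
    | succ n ih =>
      calc a 0 * s ^ (n + 1) = s * (a 0 * s ^ n) := by ring
        _ ≤ s * a n := by gcongr
        _ ≤ a (n + 1) := (key n).2
  obtain ⟨n, hn⟩ := pow_unbounded_of_one_lt (C / a 0) ((one_lt_div hR).2 hsR)
  have h1 := (hpow n).trans (hC n)
  rw [div_pow, div_lt_div_iff₀ ha0 (pow_pos hR n)] at hn
  linarith

section Positivity

variable {L : ℝ[X] →ₗ[ℝ] ℝ}

lemma nonneg_X_pow_mul_sq (h0 : ∀ q : ℝ[X], 0 ≤ L (q ^ 2)) (h1 : ∀ q : ℝ[X], 0 ≤ L (X * q ^ 2))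
    (n : ℕ) (q : ℝ[X]) : 0 ≤ L (X ^ n * q ^ 2) := by
  obtain ⟨k, rfl | rfl⟩ := n.even_or_odd'
  · convert h0 (X ^ k * q) using 2; ring
  · convert h1 (X ^ k * q) using 2; ring

/-- The Cauchy–Schwarz inequality for the form `(f, g) ↦ L (X ^ n * f * g)`, at `q` and `X * q`. -/
lemma sq_X_pow_mul_sq_le (h0 : ∀ q : ℝ[X], 0 ≤ L (q ^ 2)) (h1 : ∀ q : ℝ[X], 0 ≤ L (X * q ^ 2))
    (n : ℕ) (q : ℝ[X]) :
    L (X ^ (n + 1) * q ^ 2) ^ 2 ≤ L (X ^ n * q ^ 2) * L (X ^ (n + 2) * q ^ 2) := by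
  have h : ∀ t : ℝ, 0 ≤ L (X ^ n * q ^ 2) * (t * t) + (-2 * L (X ^ (n + 1) * q ^ 2)) * t
      + L (X ^ (n + 2) * q ^ 2) := by
    intro t
    have h2 := nonneg_X_pow_mul_sq h0 h1 n ((X - C t) * q)
    have h3 : X ^ n * ((X - C t) * q) ^ 2 = (t * t) • (X ^ n * q ^ 2)
        + (-2 * t) • (X ^ (n + 1) * q ^ 2) + X ^ (n + 2) * q ^ 2 := by
      simp only [smul_eq_C_mul, C_mul, C_neg, C_ofNat]
      ring
    rw [h3, map_add, map_add, map_smul, map_smul] at h2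
    simp only [smul_eq_mul] at h2
    linarith
  have h2 := discrim_le_zero h
  rw [discrim] at h2
  linarith

/-- A functional that is nonnegative on squares and on `X` times squares, and whose moments grow at
most like `R ^ n`, satisfies the Hausdorff positivity conditions for the interval `[0, R]`. -/
lemma hausdorff_nonneg {R : ℝ} (hR : 0 < R) (h0 : ∀ q : ℝ[X], 0 ≤ L (q ^ 2))
    (h1 : ∀ q : ℝ[X], 0 ≤ L (X * q ^ 2)) (hL : ∀ q : ℝ[X], ∃ c, ∀ n, L (X ^ n * q) ≤ c * R ^ n)
    (k m : ℕ) : 0 ≤ L (X ^ k * (C R - X) ^ m) := by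
  obtain ⟨l, rfl | rfl⟩ := m.even_or_odd'
  · convert nonneg_X_pow_mul_sq h0 h1 k ((C R - X) ^ l) using 2; ring
  · obtain ⟨c, hc⟩ := hL (X ^ k * ((C R - X) ^ l) ^ 2)
    have h := le_mul_of_logConvex (a := fun n => L (X ^ (k + n) * ((C R - X) ^ l) ^ 2)) hR
      (fun n => nonneg_X_pow_mul_sq h0 h1 _ _) (fun n => sq_X_pow_mul_sq_le h0 h1 (k + n) _)
      (C := c) (fun n => by convert hc n using 2; ring)
    have h2 : X ^ k * (C R - X) ^ (2 * l + 1) = R • (X ^ (k + 0) * ((C R - X) ^ l) ^ 2)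
        - X ^ (k + 1) * ((C R - X) ^ l) ^ 2 := by
      rw [smul_eq_C_mul]; ring
    rw [h2, map_sub, map_smul, smul_eq_mul]
    linarith

end Positivity

/-- The binomial theorem weighted by `k.choose j`. -/
lemma sum_choose_mul_choose {A : Type*} [CommSemiring A] (x y : A) {m j : ℕ} (hj : j ≤ m) :
    ∑ k ∈ Finset.range (m + 1), ((m.choose k * k.choose j : ℕ) : A) * (x ^ k * y ^ (m - k))
      = (m.choose j : A) * (x ^ j * (x + y) ^ (m - j)) := by
  obtain ⟨i, rfl⟩ := Nat.exists_eq_add_of_le hj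
  rw [add_assoc, Finset.sum_range_add, Finset.sum_eq_zero, zero_add, Nat.add_sub_cancel_left,
    add_pow, Finset.mul_sum, Finset.mul_sum]
  · refine Finset.sum_congr rfl fun k hk => ?_
    have hk' : k ≤ i := Nat.lt_succ_iff.1 (Finset.mem_range.1 hk)
    rw [Nat.choose_mul (by omega)]
    simp only [Nat.add_sub_cancel_left, Nat.add_sub_add_left, Nat.cast_mul]
    ring
  · intro k hk
    simp [Nat.choose_eq_zero_of_lt (Finset.mem_range.1 hk)]

/-- `k.choose j / m.choose j` is close to `(k / m) ^ j`, uniformly in `k ≤ m`, for large `m`. -/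
lemma exists_choose_div_choose_bound (j : ℕ) : ∃ a : ℕ → ℝ, Tendsto a atTop (𝓝 0) ∧
    ∀ m, j ≤ m → ∀ k ≤ m, |(k.choose j : ℝ) / m.choose j - ((k : ℝ) / m) ^ j| ≤ a m := by
  induction j with
  | zero => exact ⟨0, tendsto_const_nhds, by simp⟩
  | succ j ih =>
    obtain ⟨a, ha, hb⟩ := ih
    refine ⟨fun m => a m + j / ((m : ℝ) - j), ?_, fun m hm k hk => ?_⟩
    · have : Tendsto (fun m : ℕ => (j : ℝ) / ((m : ℝ) - j)) atTop (𝓝 0) :=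
        (tendsto_const_nhds).div_atTop
          (tendsto_atTop_add_const_right _ (-(j : ℝ)) tendsto_natCast_atTop_atTop)
      simpa using ha.add this
    · have hmj : (0 : ℝ) < (m : ℝ) - j := by
        have : (j : ℝ) + 1 ≤ m := by exact_mod_cast hm
        linarith
      have hm0 : (0 : ℝ) < m := by have : (0 : ℝ) ≤ j := by positivity
                                   linarith
      have hkm : (k : ℝ) ≤ m := by exact_mod_cast hk
      have hj0 : (0 : ℝ) ≤ j := by positivity
      have hk0 : (0 : ℝ) ≤ k := by positivity
      have hcm : (0 : ℝ) < m.choose j := by exact_mod_cast Nat.choose_pos (by omega)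
      have e1 : ∀ n : ℕ, (n.choose (j + 1) : ℝ) = n.choose j * ((n - j : ℕ) : ℝ) / (j + 1) := by
        intro n
        rw [eq_div_iff (by positivity)]
        exact_mod_cast Nat.choose_succ_right_eq n j
      have e2 : (k.choose (j + 1) : ℝ) / m.choose (j + 1)
          = (k.choose j : ℝ) / m.choose j * (((k - j : ℕ) : ℝ) / (m - j)) := by
        rw [e1, e1, Nat.cast_sub (show j ≤ m by omega)]
        field_simp
      have h2 : |(((k - j : ℕ) : ℝ) / (m - j)) - (k : ℝ) / m| ≤ j / ((m : ℝ) - j) := by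
        rcases le_total j k with h | h
        · rw [Nat.cast_sub h, div_sub_div _ _ hmj.ne' hm0.ne', abs_div, abs_of_pos (mul_pos hmj hm0),
            div_le_div_iff₀ (mul_pos hmj hm0) hmj, abs_of_nonpos (by nlinarith)]
          nlinarith [mul_nonneg hj0 hk0, mul_nonneg (mul_nonneg hj0 hk0) hmj.le]
        · have hkj : (k : ℝ) ≤ j := by exact_mod_cast h
          rw [Nat.sub_eq_zero_of_le h, Nat.cast_zero, zero_div, zero_sub, abs_neg,
            abs_of_nonneg (by positivity), div_le_div_iff₀ hm0 hmj]
          nlinarith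
      have h3 : |(k.choose j : ℝ) / m.choose j| ≤ 1 := by
        rw [abs_of_nonneg (by positivity), div_le_one hcm]
        exact_mod_cast Nat.choose_le_choose j hk
      have h4 : |(k : ℝ) / m| ≤ 1 := by
        rw [abs_of_nonneg (by positivity), div_le_one hm0]
        exact hkm
      have e3 : (k.choose j : ℝ) / m.choose j * (((k - j : ℕ) : ℝ) / (m - j)) - ((k : ℝ) / m) ^ (j + 1)
          = ((k.choose j : ℝ) / m.choose j - ((k : ℝ) / m) ^ j) * ((k : ℝ) / m)
            + (k.choose j : ℝ) / m.choose j * ((((k - j : ℕ) : ℝ) / (m - j)) - (k : ℝ) / m) := by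
        ring
      rw [e2, e3]
      refine (abs_add_le _ _).trans ?_
      rw [abs_mul, abs_mul]
      exact add_le_add ((mul_le_of_le_one_right (abs_nonneg _) h4).trans (hb m (by omega) k hk))
        ((mul_le_of_le_one_left (abs_nonneg _) h3).trans h2)

/-- **Hausdorff's theorem** on `[0, R]`. The approximating measures are those of Bernstein: the mass
`m.choose k * L (X ^ k * (R - X) ^ (m - k)) / R ^ m` sits at the point `R * k / m`. -/
lemma exists_measure_of_hausdorff_nonneg (L : ℝ[X] →ₗ[ℝ] ℝ) {R : ℝ} (hR : 0 < R)
    (hL : ∀ k m : ℕ, 0 ≤ L (X ^ k * (C R - X) ^ m)) :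
    ∃ σ : Measure ℝ≥0, IsFiniteMeasure σ ∧ σ (Set.Iic R.toNNReal)ᶜ = 0 ∧
      ∀ n, ∫ x : ℝ≥0, (x : ℝ) ^ n ∂σ = L (X ^ n) := by
  set w : ℕ → ℕ → ℝ := fun m k => m.choose k * L (X ^ k * (C R - X) ^ (m - k)) / R ^ m with hw
  have hw0 : ∀ m k, 0 ≤ w m k := fun m k =>
    div_nonneg (mul_nonneg (Nat.cast_nonneg _) (hL _ _)) (by positivity)
  set pt : ℕ → ℕ → ℝ≥0 := fun m k => R.toNNReal * (k / m) with hpt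
  have hptR : ∀ m k, (pt m k : ℝ) = R * (k / m) := fun m k => by simp [hpt, hR.le]
  have hptle : ∀ m k, k ≤ m → pt m k ≤ R.toNNReal := fun m k hk => by
    refine mul_le_of_le_one_right zero_le (div_le_one_of_le₀ (by exact_mod_cast hk) zero_le)
  set μ : ℕ → Measure ℝ≥0 := fun m =>
    ∑ k ∈ Finset.range (m + 1), ENNReal.ofReal (w m k) • Measure.dirac (pt m k) with hμ
  have hfin : ∀ m, IsFiniteMeasure (μ m) := fun m => by
    have : ∀ k, IsFiniteMeasure (ENNReal.ofReal (w m k) • Measure.dirac (pt m k)) :=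
      fun k => Measure.smul_finite _ ENNReal.ofReal_ne_top
    infer_instance
  -- the binomial moments of the weights
  have hbin : ∀ j m, j ≤ m →
      ∑ k ∈ Finset.range (m + 1), w m k * ((k.choose j : ℝ) / m.choose j) * R ^ j = L (X ^ j) := by
    intro j m hj
    have hcm : (m.choose j : ℝ) ≠ 0 := by exact_mod_cast (Nat.choose_pos hj).ne'
    have h := congrArg L (sum_choose_mul_choose (X : ℝ[X]) (C R - X) hj)
    have h2 : ∀ (n : ℕ) (p : ℝ[X]), L ((n : ℝ[X]) * p) = n * L p := fun n p => by
      rw [← nsmul_eq_mul, map_nsmul, nsmul_eq_mul]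
    have h3 : X ^ j * (X + (C R - X)) ^ (m - j) = R ^ (m - j) • (X ^ j : ℝ[X]) := by
      rw [smul_eq_C_mul, C_pow]; ring
    rw [map_sum, h2, h3, map_smul, smul_eq_mul] at h
    simp only [h2] at h
    have h4 : R ^ m = R ^ j * R ^ (m - j) := by rw [← pow_add, Nat.add_sub_cancel' hj]
    have h5 : L (X ^ j) = (m.choose j * (R ^ (m - j) * L (X ^ j))) / (m.choose j * R ^ m) * R ^ j := by
      rw [h4]; field_simp
    rw [h5, ← h, Finset.sum_div, Finset.sum_mul]
    refine Finset.sum_congr rfl fun k _ => ?_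
    rw [hw]
    push_cast
    field_simp
  have hsum : ∀ m, ∑ k ∈ Finset.range (m + 1), w m k = L 1 := fun m => by
    simpa using hbin 0 m (Nat.zero_le _)
  -- compactness of the set of measures of bounded mass on `[0, R]`
  set K : Set ℝ≥0 := Set.Iic R.toNNReal with hK
  have hKc : IsCompact K := by
    have : K = Set.Icc 0 R.toNNReal := by ext; simp [hK]
    rw [this]; exact isCompact_Icc
  have hcomp := isCompact_setOfPred_finiteMeasure_le_of_isCompact (L 1).toNNReal hKc
  set ν : ℕ → FiniteMeasure ℝ≥0 := fun m => ⟨μ m, hfin m⟩ with hν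
  have hmem : ∀ m, ν m ∈ {μ : FiniteMeasure ℝ≥0 | μ.mass ≤ (L 1).toNNReal ∧ μ Kᶜ = 0} := by
    intro m
    constructor
    · rw [← ENNReal.coe_le_coe, FiniteMeasure.ennreal_mass]
      change μ m Set.univ ≤ ENNReal.ofReal (L 1)
      rw [← hsum m, ENNReal.ofReal_sum_of_nonneg fun k _ => hw0 m k]
      simp [hμ, Measure.finsetSum_apply]
    · rw [FiniteMeasure.null_iff_toMeasure_null]
      change μ m Kᶜ = 0
      simp only [hμ, Measure.finsetSum_apply, Measure.smul_apply, smul_eq_mul]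
      refine Finset.sum_eq_zero fun k hk => ?_
      have : pt m k ∈ K := hptle m k (Nat.lt_succ_iff.1 (Finset.mem_range.1 hk))
      simp [Measure.dirac_apply' _ hKc.measurableSet.compl, this]
  let U : Ultrafilter ℕ := Ultrafilter.of atTop
  have hU : (U : Filter ℕ) ≤ atTop := Ultrafilter.of_le _
  obtain ⟨σ, ⟨-, hσK⟩, hσ⟩ := hcomp.ultrafilter_le_nhds' (U.map ν)
    (Ultrafilter.mem_map.2 (Filter.mem_of_superset Filter.univ_mem fun m _ => hmem m))
  have hσK' : (σ : Measure ℝ≥0) Kᶜ = 0 := (FiniteMeasure.null_iff_toMeasure_null _ _).1 hσK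
  refine ⟨σ, inferInstance, hσK', fun n => ?_⟩
  -- test against the bounded continuous function `x ↦ (min x R) ^ n`
  let g : BoundedContinuousFunction ℝ≥0 ℝ := BoundedContinuousFunction.ofNormedAddCommGroup
    (fun x => ((min x R.toNNReal : ℝ≥0) : ℝ) ^ n) (by fun_prop) (R ^ n) (fun x => by
      rw [Real.norm_of_nonneg (by positivity)]
      gcongr
      exact (NNReal.coe_le_coe.2 (min_le_right _ _)).trans (Real.coe_toNNReal _ hR.le).le)
  have hg : ∀ x ∈ K, g x = (x : ℝ) ^ n := fun x hx => by
    change ((min x R.toNNReal : ℝ≥0) : ℝ) ^ n = _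
    rw [min_eq_left hx]
  have hlim1 : Tendsto (fun m => ∫ x, g x ∂(μ m)) U (𝓝 (∫ x, g x ∂(σ : Measure ℝ≥0))) :=
    (FiniteMeasure.tendsto_iff_forall_integral_tendsto.1 hσ g)
  have hint : ∀ m, ∫ x, g x ∂(μ m) = ∑ k ∈ Finset.range (m + 1), w m k * (R * ((k : ℝ) / m)) ^ n := by
    intro m
    simp only [hμ]
    rw [integral_finsetSum_measure]
    · refine Finset.sum_congr rfl fun k hk => ?_
      rw [integral_smul_measure, integral_dirac, ENNReal.toReal_ofReal (hw0 m k), smul_eq_mul,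
        hg _ (hptle m k (Nat.lt_succ_iff.1 (Finset.mem_range.1 hk))), hptR]
    · intro k _
      have := Measure.smul_finite (Measure.dirac (pt m k)) (ENNReal.ofReal_ne_top (r := w m k))
      exact g.integrable _
  obtain ⟨a, ha, hab⟩ := exists_choose_div_choose_bound n
  have hlim2 : Tendsto (fun m => ∫ x, g x ∂(μ m)) atTop (𝓝 (L (X ^ n))) := by
    rw [tendsto_iff_norm_sub_tendsto_zero]
    have h0 : Tendsto (fun m => L 1 * R ^ n * a m) atTop (𝓝 0) := by simpa using ha.const_mul _
    refine squeeze_zero' (Eventually.of_forall fun _ => norm_nonneg _) ?_ h0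
    filter_upwards [eventually_ge_atTop n] with m hm
    rw [hint, ← hbin n m hm, ← Finset.sum_sub_distrib, ← hsum m, Finset.sum_mul, Finset.sum_mul]
    refine (norm_sum_le _ _).trans (Finset.sum_le_sum fun k hk => ?_)
    have h1 : w m k * (R * ((k : ℝ) / m)) ^ n - w m k * ((k.choose n : ℝ) / m.choose n) * R ^ n
        = w m k * R ^ n * -((k.choose n : ℝ) / m.choose n - ((k : ℝ) / m) ^ n) := by ring
    rw [h1, norm_mul, norm_neg, Real.norm_of_nonneg (mul_nonneg (hw0 m k) (by positivity))]
    exact mul_le_mul_of_nonneg_left (hab m hm k (Nat.lt_succ_iff.1 (Finset.mem_range.1 hk)))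
      (mul_nonneg (hw0 m k) (by positivity))
  rw [← tendsto_nhds_unique hlim1 (hlim2.mono_left hU)]
  refine integral_congr_ae ?_
  filter_upwards [show K ∈ ae (σ : Measure ℝ≥0) from hσK'] with x hx
  exact (hg x hx).symm

/-! ### The measure representing the second differences of the moments -/

/-- The linear functional on real polynomials with moments `γ`, that is, `X ^ n ↦ γ n`. -/
def momentFunctional (γ : ℕ → ℝ) : ℝ[X] →ₗ[ℝ] ℝ :=
  Polynomial.lsum fun n => γ n • LinearMap.id

lemma momentFunctional_C_mul_X_pow (γ : ℕ → ℝ) (a : ℝ) (n : ℕ) :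
    momentFunctional γ (C a * X ^ n) = a * γ n := by
  rw [C_mul_X_pow_eq_monomial, momentFunctional, lsum_apply,
    sum_monomial_index (f := fun k x => (γ k • (LinearMap.id : ℝ →ₗ[ℝ] ℝ)) x) a (by simp)]
  exact mul_comm _ _

lemma momentFunctional_X_pow (γ : ℕ → ℝ) (n : ℕ) : momentFunctional γ (X ^ n) = γ n := by
  simpa using momentFunctional_C_mul_X_pow γ 1 n

lemma momentFunctional_X_mul (γ : ℕ → ℝ) (p : ℝ[X]) :
    momentFunctional γ (X * p) = momentFunctional (fun n => γ (n + 1)) p := by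
  induction p using Polynomial.induction_on' with
  | add p q hp hq => rw [mul_add, map_add, map_add, hp, hq]
  | monomial n a =>
    rw [← C_mul_X_pow_eq_monomial, momentFunctional_C_mul_X_pow,
      ← momentFunctional_C_mul_X_pow γ a]
    congr 1; ring

lemma momentFunctional_sub_one_sq_mul (γ : ℕ → ℝ) (p : ℝ[X]) :
    momentFunctional γ ((X - 1) ^ 2 * p)
      = momentFunctional (fun n => γ (n + 2) - 2 * γ (n + 1) + γ n) p := by
  induction p using Polynomial.induction_on' with
  | add p q hp hq => rw [mul_add, map_add, map_add, hp, hq]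
  | monomial n a =>
    rw [← C_mul_X_pow_eq_monomial, momentFunctional_C_mul_X_pow]
    have h : (X - 1) ^ 2 * (C a * X ^ n) = C a * X ^ (n + 2) - (2 : ℝ) • (C a * X ^ (n + 1))
        + C a * X ^ n := by
      rw [smul_eq_C_mul, C_ofNat]; ring
    rw [h, map_add, map_sub, map_smul]
    simp only [momentFunctional_C_mul_X_pow, smul_eq_mul]
    ring

lemma IsCPDSeq.momentFunctional_sq_nonneg {γ : ℕ → ℝ} (h : IsCPDSeq γ) {p : ℝ[X]}
    (hp : p.eval 1 = 0) : 0 ≤ momentFunctional γ (p ^ 2) := by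
  have h1 : ∑ j ∈ Finset.range (p.natDegree + 1), ((p.coeff j : ℝ) : ℂ) = 0 := by
    rw [eval_eq_sum_range] at hp
    exact_mod_cast (by simpa using hp)
  have h2 : momentFunctional γ (p ^ 2) = ∑ i ∈ Finset.range (p.natDegree + 1),
      ∑ j ∈ Finset.range (p.natDegree + 1), γ (i + j) * p.coeff i * p.coeff j := by
    conv_lhs => rw [sq, p.as_sum_range_C_mul_X_pow, Finset.sum_mul_sum, map_sum]
    refine Finset.sum_congr rfl fun i _ => ?_
    rw [map_sum]
    refine Finset.sum_congr rfl fun j _ => ?_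
    have : C (p.coeff i) * X ^ i * (C (p.coeff j) * X ^ j)
        = C (p.coeff i * p.coeff j) * X ^ (i + j) := by rw [C_mul]; ring
    rw [this, momentFunctional_C_mul_X_pow]
    ring
  have h3 := h p.natDegree (fun j => (p.coeff j : ℂ)) h1
  simp only [Complex.conj_ofReal] at h3
  rw [h2]
  exact_mod_cast h3

/-- If `γ` is conditionally positive definite, then its sequence of second differences is positive
definite: a polynomial multiple of `X - 1` has coefficients of zero sum. -/
lemma IsCPDSeq.secondDiff_nonneg {γ : ℕ → ℝ} (h : IsCPDSeq γ) (q : ℝ[X]) :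
    0 ≤ momentFunctional (fun n => γ (n + 2) - 2 * γ (n + 1) + γ n) (q ^ 2) := by
  rw [← momentFunctional_sub_one_sq_mul, ← mul_pow]
  exact h.momentFunctional_sq_nonneg (by simp)

lemma exists_momentFunctional_X_pow_mul_le {δ : ℕ → ℝ} {R c : ℝ}
    (hδ : ∀ n, |δ n| ≤ c * R ^ n) (q : ℝ[X]) :
    ∃ c', ∀ n, momentFunctional δ (X ^ n * q) ≤ c' * R ^ n := by
  induction q using Polynomial.induction_on' with
  | add p q hp hq =>
    obtain ⟨c₁, h₁⟩ := hp
    obtain ⟨c₂, h₂⟩ := hq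
    refine ⟨c₁ + c₂, fun n => ?_⟩
    rw [mul_add, map_add, add_mul]
    exact add_le_add (h₁ n) (h₂ n)
  | monomial k a =>
    refine ⟨|a| * c * R ^ k, fun n => ?_⟩
    have : X ^ n * monomial k a = C a * X ^ (n + k) := by
      rw [← C_mul_X_pow_eq_monomial]; ring
    rw [this, momentFunctional_C_mul_X_pow]
    calc a * δ (n + k) ≤ |a * δ (n + k)| := le_abs_self _
      _ = |a| * |δ (n + k)| := abs_mul _ _
      _ ≤ |a| * (c * R ^ (n + k)) := by gcongr; exact hδ _
      _ = |a| * c * R ^ k * R ^ n := by rw [pow_add]; ring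

namespace Weights

variable (l : Weights)

lemma moment_pos (n : ℕ) : 0 < l.moment n :=
  Finset.prod_pos fun i _ => pow_pos (l.pos i) 2

lemma moment_succ (n : ℕ) : l.moment (n + 1) = l.moment n * l.w n ^ 2 :=
  Finset.prod_range_succ _ _

lemma moment_zero : l.moment 0 = 1 := Finset.prod_range_zero _

lemma moment_mul_beta (n : ℕ) :
    l.moment n * l.beta n = l.moment (n + 2) - 2 * l.moment (n + 1) + l.moment n := by
  rw [l.moment_succ (n + 1), l.moment_succ n, beta]
  ring

lemma norm_shift_pow_e_zero_sq (n : ℕ) : ‖(l.shift ^ n) (e 0)‖ ^ 2 = l.moment n := by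
  have h : (l.shift ^ n) (e 0) = ((∏ i ∈ Finset.range n, l.w i : ℝ) : ℂ) • e n := by
    induction n with
    | zero => simp
    | succ n ih =>
      rw [pow_succ', mul_apply_eq_comp, ih, map_smul, shift_e, smul_smul,
        Finset.prod_range_succ, Complex.ofReal_mul]
  rw [h, norm_smul, mul_pow, Complex.norm_real, Real.norm_eq_abs, sq_abs, ← Finset.prod_pow, e,
    lp.norm_single (by norm_num), norm_one, one_pow, mul_one]
  rfl

variable {l}

lemma isCPDSeq_moment (h : IsCPD l.shift) : IsCPDSeq l.moment := by
  have := h (e 0)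
  simpa only [norm_shift_pow_e_zero_sq] using this

lemma isCPDSeq_moment_succ (h : IsCPD l.shift) : IsCPDSeq fun n => l.moment (n + 1) := by
  have := h (l.shift (e 0))
  simpa only [← mul_apply_eq_comp, ← pow_succ, norm_shift_pow_e_zero_sq] using this

variable (l) in
lemma exists_moment_mul_beta_bound :
    ∃ R : ℝ, 0 < R ∧ ∀ n, |l.moment n * l.beta n| ≤ (R + 1) ^ 2 * R ^ n := by
  obtain ⟨C, hC0, hC⟩ := l.exists_bound
  set R := C ^ 2 with hR
  have hC1 : 0 < C := (l.pos 0).trans_le (hC 0)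
  have hR0 : 0 < R := by positivity
  have h1 : ∀ n, l.moment (n + 1) ≤ R * l.moment n := fun n => by
    rw [moment_succ, mul_comm]
    have := (l.moment_pos n).le
    exact mul_le_mul_of_nonneg_right (pow_le_pow_left₀ (l.pos n).le (hC n) 2) this
  have h2 : ∀ n, l.moment n ≤ R ^ n := by
    intro n
    induction n with
    | zero => simp [moment_zero]
    | succ n ih =>
      rw [pow_succ']
      exact (h1 n).trans (by gcongr)
  refine ⟨R, hR0, fun n => ?_⟩
  rw [moment_mul_beta, abs_le]
  have p0 := l.moment_pos n
  have p1 := l.moment_pos (n + 1)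
  have p2 := l.moment_pos (n + 2)
  have q0 := h2 n
  have q1 := h2 (n + 1)
  have q2 := h2 (n + 2)
  have e0 : (R + 1) ^ 2 * R ^ n = R ^ (n + 2) + 2 * R ^ (n + 1) + R ^ n := by ring
  constructor <;> linarith

end Weights

/-- For a conditionally positive definite weighted shift, the second differences
`l.moment n * l.beta n` of the moments are themselves the moments of a measure on a compact
interval `[0, R]`. -/
theorem exists_measure_moment_mul_beta {l : Weights} (h : IsCPD l.shift) :
    ∃ (σ : Measure ℝ≥0) (R : ℝ≥0), IsFiniteMeasure σ ∧ σ (Set.Iic R)ᶜ = 0 ∧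
      ∀ n, ∫ x : ℝ≥0, (x : ℝ) ^ n ∂σ = l.moment n * l.beta n := by
  obtain ⟨R, hR, hb⟩ := l.exists_moment_mul_beta_bound
  have h0 : ∀ q : ℝ[X], 0 ≤ momentFunctional (fun n => l.moment n * l.beta n) (q ^ 2) := fun q => by
    simp only [Weights.moment_mul_beta]
    exact (Weights.isCPDSeq_moment h).secondDiff_nonneg q
  have h1 : ∀ q : ℝ[X], 0 ≤ momentFunctional (fun n => l.moment n * l.beta n) (X * q ^ 2) :=
    fun q => by
      simp only [Weights.moment_mul_beta, momentFunctional_X_mul]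
      exact (Weights.isCPDSeq_moment_succ h).secondDiff_nonneg q
  obtain ⟨σ, hσ, hK, hm⟩ := exists_measure_of_hausdorff_nonneg _ hR
    (hausdorff_nonneg hR h0 h1 (exists_momentFunctional_X_pow_mul_le hb))
  exact ⟨σ, R.toNNReal, hσ, hK, fun n => (hm n).trans (momentFunctional_X_pow _ n)⟩

/-! ### Rotation-invariant measures -/

section Measures

/-- A finite measure with compact support is carried by that support, so every continuous function
is integrable. -/
lemma integrable_of_isCompact_support {α E : Type*} [TopologicalSpace α] [T2Space α]
    [HereditarilyLindelofSpace α] [MeasurableSpace α] [OpensMeasurableSpace α]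
    [NormedAddCommGroup E] [SecondCountableTopologyEither α E]
    {μ : Measure α} [IsFiniteMeasure μ] (hμ : IsCompact μ.support) {f : α → E}
    (hf : Continuous f) : Integrable f μ := by
  have h : μ.restrict μ.support = μ := Measure.restrict_eq_self_of_ae_mem Measure.support_mem_ae
  rw [← h]
  exact hf.continuousOn.integrableOn_compact' hμ hμ.measurableSet

/-- The rotation-invariant measure on the plane whose image under `z ↦ ‖z‖ ^ 2` is `σ`: the image of
the product of `σ` with the normalised Haar measure of the circle under `(r, t) ↦ √r * exp (2πit)`. -/
def rotationMeasure (σ : Measure ℝ≥0) : Measure ℂ :=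
  (σ.prod (AddCircle.haarAddCircle (T := 1))).map
    fun p => (NNReal.sqrt p.1 : ℂ) * (AddCircle.toCircle p.2 : ℂ)

lemma continuous_polar : Continuous fun p : ℝ≥0 × AddCircle (1 : ℝ) =>
    ((NNReal.sqrt p.1 : ℝ) : ℂ) * (AddCircle.toCircle p.2 : ℂ) := by
  have h1 : Continuous fun p : ℝ≥0 × AddCircle (1 : ℝ) => NNReal.sqrt p.1 :=
    NNReal.continuous_sqrt.comp continuous_fst
  have h2 : Continuous fun p : ℝ≥0 × AddCircle (1 : ℝ) => AddCircle.toCircle p.2 :=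
    AddCircle.continuous_toCircle.comp continuous_snd
  fun_prop

variable (σ : Measure ℝ≥0)

lemma rotationMeasure_map_sq : (rotationMeasure σ).map (fun z => ‖z‖₊ ^ 2) = σ := by
  rw [rotationMeasure, Measure.map_map (by fun_prop) continuous_polar.measurable]
  have h : (fun z : ℂ => ‖z‖₊ ^ 2) ∘ (fun p : ℝ≥0 × AddCircle (1 : ℝ) =>
      ((NNReal.sqrt p.1 : ℝ) : ℂ) * (AddCircle.toCircle p.2 : ℂ)) = Prod.fst := by
    funext p
    ext
    simp [mul_pow, Circle.norm_coe]
  rw [h]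
  exact measurePreserving_fst.map_eq

variable {σ} in
lemma isCompact_support_rotationMeasure {R : ℝ≥0} (hR : σ (Set.Iic R)ᶜ = 0) :
    IsCompact (rotationMeasure σ).support := by
  refine (isCompact_closedBall (0 : ℂ) (NNReal.sqrt R)).of_isClosed_subset Measure.isClosed_support
    (Measure.support_subset_of_isClosed Metric.isClosed_closedBall ?_)
  have h : (Metric.closedBall (0 : ℂ) (NNReal.sqrt R))ᶜ = (fun z => ‖z‖₊ ^ 2) ⁻¹' (Set.Iic R)ᶜ := by
    ext z
    simp only [Set.mem_compl_iff, Metric.mem_closedBall, dist_zero_right, Set.mem_preimage,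
      Set.mem_Iic, not_iff_not]
    rw [← NNReal.le_sqrt_iff_sq_le, ← NNReal.coe_le_coe, coe_nnnorm]
  rw [mem_ae_iff, h, ← Measure.map_apply (by fun_prop) measurableSet_Iic.compl,
    rotationMeasure_map_sq, hR]

variable [IsFiniteMeasure σ]

instance : IsFiniteMeasure (rotationMeasure σ) := by
  rw [rotationMeasure]; infer_instance

lemma rotationMeasure_map_mul (t : AddCircle (1 : ℝ)) :
    (rotationMeasure σ).map (fun z => (AddCircle.toCircle t : ℂ) * z) = rotationMeasure σ := by
  have h : MeasurePreserving (Prod.map id (t + ·)) (σ.prod (AddCircle.haarAddCircle (T := 1)))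
      (σ.prod (AddCircle.haarAddCircle (T := 1))) :=
    (MeasurePreserving.id σ).prod (measurePreserving_add_left _ t)
  rw [rotationMeasure, Measure.map_map (by fun_prop) continuous_polar.measurable]
  conv_rhs => rw [← h.map_eq, Measure.map_map continuous_polar.measurable h.measurable]
  congr 1
  funext p
  simp only [Function.comp_apply, Prod.map_fst, Prod.map_snd, id_eq, AddCircle.toCircle_add,
    Circle.coe_mul]
  ring

lemma rotationInvariant_rotationMeasure : RotationInvariant (rotationMeasure σ) := by
  intro φ _ Δ hΔ
  -- the image of a set under a rotation is its preimage under the inverse rotation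
  set t : AddCircle (1 : ℝ) := ((-φ / (2 * Real.pi) : ℝ) : AddCircle (1 : ℝ)) with ht
  have h1 : (AddCircle.toCircle t : ℂ) = Complex.exp (-(Complex.I * φ)) := by
    rw [ht, AddCircle.toCircle_apply_mk, Circle.coe_exp]
    congr 1
    push_cast
    have : (Real.pi : ℂ) ≠ 0 := by exact_mod_cast Real.pi_ne_zero
    field_simp
  have h2 : (fun z => Complex.exp (Complex.I * φ) * z) '' Δ
      = (fun z => (AddCircle.toCircle t : ℂ) * z) ⁻¹' Δ := by
    refine congrFun (Set.image_eq_preimage_of_inverse (fun z => ?_) fun z => ?_) Δ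
    · rw [h1, ← mul_assoc, ← Complex.exp_add, neg_add_cancel, Complex.exp_zero, one_mul]
    · rw [h1, ← mul_assoc, ← Complex.exp_add, add_neg_cancel, Complex.exp_zero, one_mul]
  rw [h2, ← Measure.map_apply (by fun_prop) hΔ, rotationMeasure_map_mul]

end Measures

/-! ### The space `H²(ρ)` of a rotation-invariant measure -/

section Hardy

variable {ρ : Measure ℂ}

/-- The monomial `z ^ n` as an element of `H²(ρ)`, obtained by applying `M_z ^ n` to the constant
function `1`; see `monoZ_ae` for its values. -/
def monoZ [IsFiniteMeasure ρ] (hρ : IsCompact ρ.support) (n : ℕ) : H2 ρ :=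
  (Mz hρ ^ n) ⟨(memLp_const (1 : ℂ)).toLp, Submodule.le_topologicalClosure _
    ⟨1, by
      filter_upwards [(memLp_const (μ := ρ) (p := 2) (1 : ℂ)).coeFn_toLp] with z hz
      rw [hz, eval_one]⟩⟩

variable [IsFiniteMeasure ρ] (hρ : IsCompact ρ.support)

lemma Mz_monoZ (n : ℕ) : Mz hρ (monoZ hρ n) = monoZ hρ (n + 1) := by
  rw [monoZ, monoZ, pow_succ', mul_apply_eq_comp]

lemma monoZ_ae (n : ℕ) : (monoZ hρ n : Lp ℂ 2 ρ) =ᵐ[ρ] fun z => z ^ n := by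
  induction n with
  | zero =>
    filter_upwards [(memLp_const (μ := ρ) (p := 2) (1 : ℂ)).coeFn_toLp] with z hz
    simpa [monoZ] using hz
  | succ n ih =>
    rw [← Mz_monoZ]
    filter_upwards [Mz_ae hρ (monoZ hρ n), ih] with z h1 h2
    rw [h1, h2, pow_succ']

lemma inner_monoZ (m n : ℕ) :
    inner ℂ (monoZ hρ m) (monoZ hρ n) = ∫ z, (starRingEnd ℂ z) ^ m * z ^ n ∂ρ := by
  rw [Submodule.coe_inner, L2.inner_def]
  refine integral_congr_ae ?_
  filter_upwards [monoZ_ae hρ m, monoZ_ae hρ n] with z h1 h2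
  rw [h1, h2, RCLike.inner_apply, map_pow, mul_comm]

/-- The rotation by `1 / (2 * (n - m))` of a full turn multiplies the inner product of `z ^ m` and
`z ^ n` by `-1`. -/
lemma inner_monoZ_of_ne (hrot : ∀ t : AddCircle (1 : ℝ),
    ρ.map (fun z => (AddCircle.toCircle t : ℂ) * z) = ρ) {m n : ℕ} (hmn : m ≠ n) :
    inner ℂ (monoZ hρ m) (monoZ hρ n) = 0 := by
  have hd : ((n : ℤ) - m : ℝ) ≠ 0 := by
    rw [sub_ne_zero]; exact_mod_cast hmn.symm
  set t : AddCircle (1 : ℝ) := ((1 / (2 * ((n : ℤ) - m : ℝ)) : ℝ) : AddCircle (1 : ℝ)) with ht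
  have h1 : (AddCircle.toCircle t : ℂ) ^ ((n : ℤ) - m) = -1 := by
    rw [← Circle.coe_zpow, ← AddCircle.toCircle_zsmul, ht, ← AddCircle.coe_zsmul,
      AddCircle.toCircle_apply_mk, Circle.coe_exp, ← Complex.exp_pi_mul_I]
    congr 2
    rw [zsmul_eq_mul]
    push_cast
    push_cast at hd
    have hd' : ((n : ℂ) - m) ≠ 0 := by exact_mod_cast hd
    field_simp
  have h2 : (starRingEnd ℂ (AddCircle.toCircle t : ℂ)) ^ m * (AddCircle.toCircle t : ℂ) ^ n = -1 := by
    rw [← h1, zpow_sub₀ (Circle.coe_ne_zero _), ← Circle.coe_inv_eq_conj, Circle.coe_inv, inv_pow,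
      zpow_natCast, zpow_natCast, div_eq_inv_mul]
  rw [inner_monoZ]
  have h3 : ∫ z, (starRingEnd ℂ z) ^ m * z ^ n ∂ρ = -∫ z, (starRingEnd ℂ z) ^ m * z ^ n ∂ρ := by
    conv_lhs => rw [← hrot t, integral_map (by fun_prop) (by fun_prop)]
    rw [← integral_neg]
    congr 1
    funext z
    rw [map_mul, mul_pow, mul_pow]
    linear_combination ((starRingEnd ℂ z) ^ m * z ^ n) * h2
  exact self_eq_neg.1 h3

lemma norm_monoZ_sq (n : ℕ) :
    ‖monoZ hρ n‖ ^ 2 = ∫ x : ℝ≥0, (x : ℝ) ^ n ∂(ρ.map fun z => ‖z‖₊ ^ 2) := by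
  have h : ((‖monoZ hρ n‖ ^ 2 : ℝ) : ℂ) = inner ℂ (monoZ hρ n) (monoZ hρ n) := by
    rw [inner_self_eq_norm_sq_to_K (𝕜 := ℂ) (monoZ hρ n)]; norm_cast
  rw [inner_monoZ] at h
  rw [integral_map (by fun_prop) (by fun_prop)]
  have h2 : ∀ z : ℂ, (starRingEnd ℂ z) ^ n * z ^ n = (((‖z‖₊ ^ 2 : ℝ≥0) : ℝ) ^ n : ℝ) := fun z => by
    rw [← mul_pow, Complex.conj_mul']; push_cast; rfl
  simp only [h2] at h
  rw [integral_complex_ofReal] at h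
  exact_mod_cast h

/-- The monomials span a dense subspace of `H²(ρ)`. -/
lemma dense_span_monoZ : (Submodule.span ℂ (Set.range (monoZ hρ))).topologicalClosure = ⊤ := by
  have hpoly : ∀ p : ℂ[X], ∃ y ∈ Submodule.span ℂ (Set.range (monoZ hρ)),
      (y : Lp ℂ 2 ρ) =ᵐ[ρ] fun z => p.eval z := by
    intro p
    induction p using Polynomial.induction_on' with
    | add p q hp hq =>
      obtain ⟨y, hy, hyp⟩ := hp
      obtain ⟨y', hy', hyq⟩ := hq
      refine ⟨y + y', add_mem hy hy', ?_⟩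
      filter_upwards [Lp.coeFn_add (y : Lp ℂ 2 ρ) y', hyp, hyq] with z h1 h2 h3
      rw [Submodule.coe_add, h1, Pi.add_apply, h2, h3, eval_add]
    | monomial n a =>
      refine ⟨a • monoZ hρ n, Submodule.smul_mem _ _ (Submodule.subset_span ⟨n, rfl⟩), ?_⟩
      filter_upwards [Lp.coeFn_smul a (monoZ hρ n : Lp ℂ 2 ρ), monoZ_ae hρ n] with z h1 h2
      rw [Submodule.coe_smul, h1, Pi.smul_apply, h2, eval_monomial, smul_eq_mul]
  rw [← Submodule.dense_iff_topologicalClosure_eq_top, Subtype.dense_iff]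
  refine closure_mono ?_
  rintro f ⟨p, hp⟩
  obtain ⟨y, hy, hyp⟩ := hpoly p
  exact ⟨y, hy, Lp.ext (hyp.trans hp.symm)⟩

end Hardy

/-! ### Operators determined by the standard basis -/

/-- The standard orthonormal basis `e` of `ℓ²`. -/
def stdBasis : HilbertBasis ℕ ℂ Ell2 := HilbertBasis.ofRepr (LinearIsometryEquiv.refl ℂ Ell2)

lemma coe_stdBasis : ⇑stdBasis = e := by
  funext n
  exact (stdBasis.repr_symm_single n).symm

lemma orthonormal_e : Orthonormal ℂ e := coe_stdBasis ▸ stdBasis.orthonormal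

lemma dense_span_e : Dense (Submodule.span ℂ (Set.range e) : Set Ell2) := by
  rw [Submodule.dense_iff_topologicalClosure_eq_top, ← coe_stdBasis, stdBasis.dense_span]

lemma inner_e (n : ℕ) (x : Ell2) : inner ℂ (e n) x = x n := by
  have := stdBasis.repr_apply_apply x n
  rw [coe_stdBasis] at this
  exact this.symm

lemma inner_e_e (m n : ℕ) : inner ℂ (e m) (e n) = if m = n then (1 : ℂ) else 0 :=
  orthonormal_iff_ite.1 orthonormal_e m n

lemma ell2_ext {x y : Ell2} (h : ∀ n, inner ℂ (e n) x = inner ℂ (e n) y) : x = y := by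
  ext n
  simpa only [inner_e] using h n

lemma norm_e (n : ℕ) : ‖e n‖ = 1 := orthonormal_e.1 n

lemma clm_ext_e {F : Type*} [NormedAddCommGroup F] [NormedSpace ℂ F] {A B : Ell2 →L[ℂ] F}
    (h : ∀ n, A (e n) = B (e n)) : A = B :=
  ContinuousLinearMap.ext_on dense_span_e (by rintro _ ⟨n, rfl⟩; exact h n)

section Orthogonal

variable {K : Type*} [NormedAddCommGroup K] [InnerProductSpace ℂ K]

lemma pairwise_inner_smul_eq_zero {v : ℕ → K} (hv : Pairwise fun m n => inner ℂ (v m) (v n) = 0)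
    (c : ℕ → ℂ) : Pairwise fun m n => inner ℂ (c m • v m) (c n • v n) = 0 := fun m n hmn => by
  beta_reduce
  rw [inner_smul_left, inner_smul_right, hv hmn, mul_zero, mul_zero]

lemma norm_linearCombination_sq {v : ℕ → K} (hv : Pairwise fun m n => inner ℂ (v m) (v n) = 0)
    (c : ℕ →₀ ℂ) :
    ‖Finsupp.linearCombination ℂ v c‖ ^ 2 = ∑ n ∈ c.support, ‖c n‖ ^ 2 * ‖v n‖ ^ 2 := by
  have h : ((‖Finsupp.linearCombination ℂ v c‖ ^ 2 : ℝ) : ℂ)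
      = ((∑ n ∈ c.support, ‖c n‖ ^ 2 * ‖v n‖ ^ 2 : ℝ) : ℂ) := by
    have h1 := inner_self_eq_norm_sq_to_K (𝕜 := ℂ) (Finsupp.linearCombination ℂ v c)
    push_cast
    refine h1.symm.trans ?_
    rw [Finsupp.linearCombination_apply, Finsupp.sum, sum_inner]
    refine Finset.sum_congr rfl fun n hn => ?_
    rw [inner_sum, Finset.sum_eq_single_of_mem n hn]
    · rw [inner_smul_left, inner_smul_right, ← mul_assoc, Complex.conj_mul',
        inner_self_eq_norm_sq_to_K (𝕜 := ℂ) (v n)]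
      rfl
    · intro m _ hm
      rw [inner_smul_left, inner_smul_right, hv hm.symm, mul_zero, mul_zero]
  exact_mod_cast h

/-- A bounded orthogonal sequence, in which zero vectors are allowed, is the image of the standard
basis of `ℓ²` under a bounded operator. -/
lemma exists_clm_of_orthogonal [CompleteSpace K] {v : ℕ → K}
    (hv : Pairwise fun m n => inner ℂ (v m) (v n) = 0) {B : ℝ} (hB : ∀ n, ‖v n‖ ≤ B) :
    ∃ X : Ell2 →L[ℂ] K, ∀ n, X (e n) = v n := by
  have hdense : DenseRange (Finsupp.linearCombination ℂ e) := by
    have := dense_span_e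
    rwa [← Finsupp.range_linearCombination, LinearMap.coe_range] at this
  have hB0 : 0 ≤ B := (norm_nonneg _).trans (hB 0)
  have hbound : ∀ c, ‖Finsupp.linearCombination ℂ v c‖ ≤ B * ‖Finsupp.linearCombination ℂ e c‖ := by
    intro c
    refine le_of_sq_le_sq ?_ (by positivity)
    rw [mul_pow, norm_linearCombination_sq hv,
      norm_linearCombination_sq fun m n h => orthonormal_e.2 h, Finset.mul_sum]
    refine Finset.sum_le_sum fun n _ => ?_
    rw [norm_e, one_pow, mul_one, mul_comm]
    gcongr
    exact hB n
  refine ⟨(Finsupp.linearCombination ℂ v).extendOfNorm (Finsupp.linearCombination ℂ e), fun n => ?_⟩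
  simpa using LinearMap.extendOfNorm_eq hdense ⟨B, hbound⟩ (Finsupp.single n 1)

/-- An operator that maps each term of an orthogonal sequence of nonzero vectors with dense span to
the next one is a weighted shift. -/
lemma exists_weightedShift [CompleteSpace K] {v : ℕ → K}
    (hv : Pairwise fun m n => inner ℂ (v m) (v n) = 0) (hv0 : ∀ n, v n ≠ 0)
    (hspan : (Submodule.span ℂ (Set.range v)).topologicalClosure = ⊤) {M : K →L[ℂ] K}
    (hM : ∀ n, M (v n) = v (n + 1)) :
    ∃ (ω : Weights) (U : K ≃ₗᵢ[ℂ] Ell2), (∀ h, U (M h) = ω.shift (U h)) ∧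
      ∀ n, ω.moment n = ‖v n‖ ^ 2 / ‖v 0‖ ^ 2 := by
  have hpos : ∀ n, 0 < ‖v n‖ := fun n => norm_pos_iff.2 (hv0 n)
  let ω : Weights :=
    { w := fun n => ‖v (n + 1)‖ / ‖v n‖
      pos := fun n => div_pos (hpos _) (hpos _)
      bdd := ⟨‖M‖, by
        rintro _ ⟨n, rfl⟩
        simp only [div_le_iff₀ (hpos n), ← hM]
        exact M.le_opNorm _⟩ }
  set u : ℕ → K := fun n => ((‖v n‖⁻¹ : ℝ) : ℂ) • v n with hu
  have huo : Orthonormal ℂ u := by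
    refine ⟨fun n => ?_, pairwise_inner_smul_eq_zero hv _⟩
    rw [hu, norm_smul, Complex.norm_real, norm_inv, norm_norm, inv_mul_cancel₀ (hpos n).ne']
  have hus : (⊤ : Submodule ℂ K) ≤ (Submodule.span ℂ (Set.range u)).topologicalClosure := by
    rw [← hspan]
    refine Submodule.topologicalClosure_mono (Submodule.span_le.2 ?_)
    rintro _ ⟨n, rfl⟩
    have h1 : v n = ((‖v n‖ : ℝ) : ℂ) • u n := by
      rw [hu, smul_smul, ← Complex.ofReal_mul, mul_inv_cancel₀ (hpos n).ne', Complex.ofReal_one,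
        one_smul]
    rw [h1]
    exact Submodule.smul_mem _ _ (Submodule.subset_span ⟨n, rfl⟩)
  let b : HilbertBasis ℕ ℂ K := HilbertBasis.mk huo hus
  have hb : ∀ n, b.repr (u n) = e n := fun n => by
    have h1 : b n = u n := congrFun (HilbertBasis.coe_mk huo hus) n
    rw [← h1]
    exact b.repr_self n
  have hMu : ∀ n, M (u n) = (ω.w n : ℂ) • u (n + 1) := fun n => by
    have h1 : ω.w n = ‖v (n + 1)‖ / ‖v n‖ := rfl
    simp only [hu]
    rw [map_smul, hM, smul_smul, ← Complex.ofReal_mul, h1]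
    congr 2
    have := (hpos n).ne'
    have := (hpos (n + 1)).ne'
    field_simp
  refine ⟨ω, b.repr, fun h => ?_, fun n => ?_⟩
  · have hdense : Dense (Submodule.span ℂ (Set.range u) : Set K) := by
      rw [Submodule.dense_iff_topologicalClosure_eq_top]
      exact top_le_iff.1 hus
    have h1 : (b.repr.toContinuousLinearEquiv : K →L[ℂ] Ell2) ∘L M
        = ω.shift ∘L (b.repr.toContinuousLinearEquiv : K →L[ℂ] Ell2) := by
      refine ContinuousLinearMap.ext_on hdense ?_
      rintro _ ⟨n, rfl⟩
      change b.repr (M (u n)) = ω.shift (b.repr (u n))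
      rw [hMu, map_smul, hb, hb, Weights.shift_e]
    exact congrArg (fun A : K →L[ℂ] Ell2 => A h) h1
  · induction n with
    | zero => rw [Weights.moment_zero, div_self (pow_pos (hpos 0) 2).ne']
    | succ n ih =>
      have h1 : ω.w n = ‖v (n + 1)‖ / ‖v n‖ := rfl
      rw [Weights.moment_succ, ih, h1]
      have := (hpos n).ne'
      have := (hpos 0).ne'
      field_simp

end Orthogonal

/-! ### The operator `I - 2T*T + T*²T²` of a weighted shift -/

section Bscr

variable (l : Weights)

lemma adjoint_shift_e (n : ℕ) :
    ContinuousLinearMap.adjoint l.shift (e (n + 1)) = (l.w n : ℂ) • e n := by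
  refine ell2_ext fun m => ?_
  rw [ContinuousLinearMap.adjoint_inner_right, Weights.shift_e, inner_smul_left,
    inner_smul_right, inner_e_e, inner_e_e, Complex.conj_ofReal]
  by_cases h : m = n
  · simp [h]
  · simp [h]

lemma bscr_two_e (n : ℕ) : bscr 2 l.shift (e n) = (l.beta n : ℂ) • e n := by
  have h1 : ContinuousLinearMap.adjoint l.shift (l.shift (e n)) = ((l.w n ^ 2 : ℝ) : ℂ) • e n := by
    rw [Weights.shift_e, map_smul, adjoint_shift_e, smul_smul]
    push_cast; rw [sq]
  have h2 : bscr 2 l.shift (e n) = e n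
      - (2 : ℂ) • ContinuousLinearMap.adjoint l.shift (l.shift (e n))
      + ContinuousLinearMap.adjoint l.shift
        (ContinuousLinearMap.adjoint l.shift (l.shift (l.shift (e n)))) := by
    simp [bscr, Finset.sum_range_succ, sq, sub_eq_add_neg]
  rw [h2, h1, Weights.shift_e, map_smul, Weights.shift_e, map_smul, map_smul, map_smul, map_smul,
    adjoint_shift_e, map_smul, adjoint_shift_e]
  simp only [smul_smul, Weights.beta]
  rw [← one_smul ℂ (e n)]
  simp only [smul_smul, ← sub_smul, ← add_smul]
  congr 1
  push_cast
  ring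

lemma bscr_two_apply (x : Ell2) (n : ℕ) : bscr 2 l.shift x n = l.beta n * x n := by
  have h : (innerSL ℂ (e n)) ∘L bscr 2 l.shift = (l.beta n : ℂ) • innerSL ℂ (e n) := by
    refine clm_ext_e fun m => ?_
    simp only [ContinuousLinearMap.comp_apply, smul_apply, innerSL_apply_apply,
      bscr_two_e, inner_smul_right, inner_e_e, smul_eq_mul]
    by_cases h : n = m
    · simp [h]
    · simp [h]
  have h2 := congrArg (fun A : Ell2 →L[ℂ] ℂ => A x) h
  simpa only [ContinuousLinearMap.comp_apply, smul_apply, innerSL_apply_apply,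
      inner_e, smul_eq_mul] using h2

/-- An operator inequality for `bscr 2 l.shift` can be tested on the diagonal: in the standard basis
this operator is diagonal with entries `l.beta n`. -/
lemma smul_id_le_bscr_two_iff (ε : ℝ) :
    (ε : ℂ) • ContinuousLinearMap.id ℂ Ell2 ≤ bscr 2 l.shift ↔ ∀ n, ε ≤ l.beta n := by
  rw [ContinuousLinearMap.le_def]
  constructor
  · intro h n
    have h1 := h.re_inner_nonneg_right (e n)
    rw [sub_apply, bscr_two_e, inner_sub_right, inner_smul_right,
      smul_apply, ContinuousLinearMap.id_apply, inner_smul_right, inner_e_e,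
      if_pos rfl, mul_one, mul_one, ← Complex.ofReal_sub] at h1
    exact sub_nonneg.1 (by simpa using h1)
  · intro h
    rw [ContinuousLinearMap.isPositive_iff_complex]
    intro x
    have h1 : inner ℂ ((bscr 2 l.shift - (ε : ℂ) • ContinuousLinearMap.id ℂ Ell2) x) x
        = ((∑' n, (l.beta n - ε) * ‖x n‖ ^ 2 : ℝ) : ℂ) := by
      rw [lp.inner_eq_tsum, Complex.ofReal_tsum]
      congr 1
      funext n
      have h2 : ((bscr 2 l.shift - (ε : ℂ) • ContinuousLinearMap.id ℂ Ell2) x) n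
          = ((l.beta n - ε : ℝ) : ℂ) * x n := by
        change bscr 2 l.shift x n - (ε : ℂ) * x n = _
        rw [bscr_two_apply]; push_cast; ring
      rw [h2, RCLike.inner_apply, map_mul, Complex.conj_ofReal, mul_left_comm, Complex.mul_conj']
      push_cast; rfl
    rw [h1]
    refine ⟨by simp, ?_⟩
    rw [RCLike.re_to_complex, Complex.ofReal_re]
    exact tsum_nonneg fun n => mul_nonneg (sub_nonneg.2 (h n)) (by positivity)

variable {l} {K : Type*} [NormedAddCommGroup K] [InnerProductSpace ℂ K] [CompleteSpace K]
  {X : Ell2 →L[ℂ] K}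

lemma adjoint_comp_self_eq_bscr (hX : Pairwise fun m n => inner ℂ (X (e m)) (X (e n)) = 0)
    (hβ : ∀ n, ‖X (e n)‖ ^ 2 = l.beta n) :
    ContinuousLinearMap.adjoint X ∘L X = bscr 2 l.shift := by
  refine clm_ext_e fun n => ell2_ext fun m => ?_
  rw [ContinuousLinearMap.comp_apply, ContinuousLinearMap.adjoint_inner_right,
    bscr_two_e, inner_smul_right, inner_e_e]
  by_cases h : m = n
  · subst h
    rw [inner_self_eq_norm_sq_to_K (𝕜 := ℂ), if_pos rfl, mul_one, ← hβ]
    norm_cast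
  · rw [hX h, if_neg h, mul_zero]

section AdjointCompSelf

variable (hX : ContinuousLinearMap.adjoint X ∘L X = bscr 2 l.shift)

include hX

lemma norm_sq_eq_re_inner_bscr (h : Ell2) : ‖X h‖ ^ 2 = (inner ℂ h (bscr 2 l.shift h)).re := by
  rw [← hX, ContinuousLinearMap.comp_apply, ContinuousLinearMap.adjoint_inner_right,
    ← inner_self_eq_norm_sq (𝕜 := ℂ)]
  rfl

lemma norm_apply_e_sq (n : ℕ) : ‖X (e n)‖ ^ 2 = l.beta n := by
  rw [norm_sq_eq_re_inner_bscr hX, bscr_two_e, inner_smul_right, inner_e_e]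
  simp

lemma injective_iff_beta_pos : Function.Injective X ↔ ∀ n, 0 < l.beta n := by
  constructor
  · intro hinj n
    rw [← norm_apply_e_sq hX]
    have h1 : X (e n) ≠ 0 := (map_ne_zero_iff X hinj).2 (norm_pos_iff.1 (by rw [norm_e]; norm_num))
    have := norm_pos_iff.2 h1
    positivity
  · intro hβ
    refine (injective_iff_map_eq_zero X).2 fun x hx => ?_
    ext n
    have h1 : bscr 2 l.shift x = 0 := by
      rw [← hX, ContinuousLinearMap.comp_apply, hx, map_zero]
    have h2 := bscr_two_apply l x n
    rw [h1] at h2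
    have h3 : (l.beta n : ℂ) ≠ 0 := by exact_mod_cast (hβ n).ne'
    simpa [h3] using h2.symm

lemma hasBoundedInverse_iff (hdense : DenseRange X) : HasBoundedInverse X ↔
    ∃ ε : ℝ, 0 < ε ∧ (ε : ℂ) • ContinuousLinearMap.id ℂ Ell2 ≤ bscr 2 l.shift := by
  constructor
  · rintro ⟨Y, hYX, -⟩
    refine ⟨((‖Y‖ + 1) ^ 2)⁻¹, by positivity, (smul_id_le_bscr_two_iff l _).2 fun n => ?_⟩
    rw [← norm_apply_e_sq hX, inv_le_iff_one_le_mul₀ (by positivity), ← mul_pow]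
    refine one_le_pow₀ ?_
    have h1 : Y (X (e n)) = e n := congrArg (fun A : Ell2 →L[ℂ] Ell2 => A (e n)) hYX
    calc (1 : ℝ) = ‖Y (X (e n))‖ := by rw [h1, norm_e]
      _ ≤ ‖Y‖ * ‖X (e n)‖ := Y.le_opNorm _
      _ ≤ ‖X (e n)‖ * (‖Y‖ + 1) := by nlinarith [norm_nonneg (X (e n))]
  · rintro ⟨ε, hε, hle⟩
    -- `X` is bounded below, so its range is closed, and being dense it is everything
    have hlow : ∀ h, ε * ‖h‖ ^ 2 ≤ ‖X h‖ ^ 2 := fun h => by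
      have h1 := hle.re_inner_nonneg_right h
      rw [sub_apply, inner_sub_right, map_sub, smul_apply,
        ContinuousLinearMap.id_apply, inner_smul_right, sub_nonneg] at h1
      rw [norm_sq_eq_re_inner_bscr hX, ← inner_self_eq_norm_sq (𝕜 := ℂ) h]
      simpa using h1
    have hanti : AntilipschitzWith (Real.toNNReal (Real.sqrt ε)⁻¹) X := by
      refine X.antilipschitz_of_bound fun h => ?_
      rw [Real.coe_toNNReal _ (by positivity), inv_mul_eq_div, le_div_iff₀ (by positivity)]
      refine le_of_sq_le_sq ?_ (norm_nonneg _)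
      rw [mul_pow, Real.sq_sqrt hε.le, mul_comm]
      exact hlow h
    have hclosed : IsClosed (Set.range X) := hanti.isClosed_range X.uniformContinuous
    have hsurj : Function.Surjective X := by
      rw [← Set.range_eq_univ, ← hclosed.closure_eq]
      exact hdense.closure_range
    let E := ContinuousLinearEquiv.ofBijective X (LinearMap.ker_eq_bot.2 hanti.injective)
      (LinearMap.range_eq_top.2 hsurj)
    refine ⟨E.symm, ?_, ?_⟩
    · ext1 h
      exact E.symm_apply_apply h
    · ext1 k
      exact E.apply_symm_apply k

end AdjointCompSelf

end Bscr

/-! ### Scalar representing triplets -/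

section Triplet

lemma Q_zero (x : ℝ) : Q 0 x = 0 := by simp [Q]

lemma Q_one (x : ℝ) : Q 1 x = 0 := by simp [Q]

lemma Q_secondDiff (n : ℕ) (x : ℝ) : Q (n + 2) x = 2 * Q (n + 1) x - Q n x + x ^ n := by
  have h0 : Q n x = ∑ j ∈ Finset.range n, ((n : ℝ) - j - 1) * x ^ j := by
    cases n with
    | zero => simp [Q]
    | succ n => rw [Finset.sum_range_succ]; simp [Q]
  have h1 : Q (n + 1) x = ∑ j ∈ Finset.range n, (((n + 1 : ℕ) : ℝ) - j - 1) * x ^ j := rfl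
  have h2 : Q (n + 2) x = ∑ j ∈ Finset.range n, (((n + 2 : ℕ) : ℝ) - j - 1) * x ^ j + x ^ n := by
    rw [Q, show n + 2 - 1 = n + 1 from rfl, Finset.sum_range_succ]
    push_cast; ring
  rw [h0, h1, h2, Finset.mul_sum, ← Finset.sum_sub_distrib]
  congr 1
  refine Finset.sum_congr rfl fun j _ => ?_
  push_cast; ring

lemma continuous_Q (n : ℕ) : Continuous fun x : ℝ≥0 => Q n (x : ℝ) := by
  unfold Q
  fun_prop

lemma integral_Q_secondDiff {ν : Measure ℝ≥0} [IsFiniteMeasure ν] (hν : IsCompact ν.support)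
    (n : ℕ) : ∫ x : ℝ≥0, Q (n + 2) (x : ℝ) ∂ν = 2 * ∫ x : ℝ≥0, Q (n + 1) (x : ℝ) ∂ν
      - ∫ x : ℝ≥0, Q n (x : ℝ) ∂ν + ∫ x : ℝ≥0, (x : ℝ) ^ n ∂ν := by
  have hQ : ∀ k, Integrable (fun x : ℝ≥0 => Q k (x : ℝ)) ν :=
    fun k => integrable_of_isCompact_support hν (continuous_Q k)
  simp only [Q_secondDiff]
  have hsub : Integrable (fun x : ℝ≥0 => 2 * Q (n + 1) (x : ℝ) - Q n (x : ℝ)) ν :=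
    ((hQ _).const_mul _).sub (hQ _)
  rw [integral_add hsub (integrable_of_isCompact_support hν (by fun_prop)),
    integral_sub ((hQ _).const_mul _) (hQ _), integral_const_mul]

variable {l : Weights} {b c : ℝ} {ν : Measure ℝ≥0}

lemma IsScalarTriplet.moment_mul_beta (h : IsScalarTriplet l b c ν) (n : ℕ) :
    l.moment n * l.beta n = 2 * c + ∫ x : ℝ≥0, (x : ℝ) ^ n ∂ν := by
  have := h.finite
  rw [Weights.moment_mul_beta, h.moment_eq, h.moment_eq, h.moment_eq,
    integral_Q_secondDiff h.compact]
  push_cast; ring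

lemma isScalarTriplet_of_moment_mul_beta (hc : 0 ≤ c) [IsFiniteMeasure ν] (hν : IsCompact ν.support)
    (h1 : ν {1} = 0) (h : ∀ n, l.moment n * l.beta n = 2 * c + ∫ x : ℝ≥0, (x : ℝ) ^ n ∂ν) :
    IsScalarTriplet l (l.moment 1 - 1 - c) c ν := by
  refine ⟨hc, inferInstance, hν, h1, fun n => ?_⟩
  induction n using Nat.twoStepInduction with
  | zero => simp [Weights.moment_zero, Q_zero]
  | one =>
    simp only [Q_one, integral_zero]
    push_cast; ring
  | more n ih1 ih2 =>
    have h2 := h n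
    rw [Weights.moment_mul_beta] at h2
    rw [integral_Q_secondDiff hν]
    push_cast at ih2 ⊢
    linear_combination h2 + 2 * ih2 - ih1

/-- A contribution `2 * c > 0`, or mass of `ν` away from `0`, makes every `2 * c + ∫ x ^ n ∂ν`
positive. -/
lemma beta_pos_of_isTypeIII (h : IsTypeIII l) (n : ℕ) : 0 < l.beta n := by
  obtain ⟨b, c, ν, ht, hIII⟩ := h
  have := ht.finite
  have hint0 : 0 ≤ ∫ x : ℝ≥0, (x : ℝ) ^ n ∂ν := integral_nonneg fun x => by positivity
  refine pos_of_mul_pos_right (a := l.moment n) ?_ (l.moment_pos n).le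
  rw [ht.moment_mul_beta]
  rcases hIII with hs | hc
  · obtain ⟨x, hx, hx0⟩ := Set.not_subset.1 hs
    have hpos : 0 < ∫ x : ℝ≥0, (x : ℝ) ^ n ∂ν := by
      rw [integral_pos_iff_support_of_nonneg (fun x => by positivity)
        (integrable_of_isCompact_support ht.compact (by fun_prop))]
      refine ((Measure.mem_support_iff_forall x).1 hx _ (isOpen_compl_singleton.mem_nhds hx0)).trans_le
        (measure_mono fun y hy => ?_)
      exact pow_ne_zero n (NNReal.coe_ne_zero.2 hy)
    linarith [ht.c_nonneg]
  · have := ht.c_nonneg.lt_of_ne' hc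
    linarith

lemma isCompact_support_of_compl_Iic {R : ℝ≥0} (h : ν (Set.Iic R)ᶜ = 0) : IsCompact ν.support := by
  have h1 : IsCompact (Set.Iic R) := by
    rw [← Set.Icc_bot]; exact isCompact_Icc
  exact h1.of_isClosed_subset Measure.isClosed_support
    (Measure.support_subset_of_isClosed isClosed_Iic h)

/-- The scalar representing triplet is read off from the measure `σ` representing the second
differences: `2 * c` is the mass of `σ` at `1`, and `ν` is the rest of `σ`. -/
lemma isScalarTriplet_restrict_compl_one {σ : Measure ℝ≥0} [IsFiniteMeasure σ] {R : ℝ≥0}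
    (hR : σ (Set.Iic R)ᶜ = 0)
    (hσ : ∀ n, ∫ x : ℝ≥0, (x : ℝ) ^ n ∂σ = l.moment n * l.beta n) :
    IsScalarTriplet l (l.moment 1 - 1 - σ.real {1} / 2) (σ.real {1} / 2) (σ.restrict {1}ᶜ) := by
  have hν : IsCompact (σ.restrict {1}ᶜ).support := by
    refine isCompact_support_of_compl_Iic (R := R) ?_
    exact le_antisymm ((Measure.restrict_apply_le _ _).trans hR.le) zero_le
  refine isScalarTriplet_of_moment_mul_beta (by positivity) hν (by simp) fun n => ?_
  have hi : Integrable (fun x : ℝ≥0 => (x : ℝ) ^ n) σ :=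
    integrable_of_isCompact_support (isCompact_support_of_compl_Iic hR) (by fun_prop)
  rw [← hσ, ← integral_add_compl (measurableSet_singleton (1 : ℝ≥0)) hi, integral_singleton]
  simp [mul_div_cancel₀]

lemma measure_ne_zero_of_not_isTypeI (hI : ¬ IsTypeI l) {σ : Measure ℝ≥0} [IsFiniteMeasure σ]
    {R : ℝ≥0} (hR : σ (Set.Iic R)ᶜ = 0)
    (hσ : ∀ n, ∫ x : ℝ≥0, (x : ℝ) ^ n ∂σ = l.moment n * l.beta n) : σ ≠ 0 := by
  intro h0
  refine hI ⟨_, _, _, isScalarTriplet_restrict_compl_one hR hσ, ?_, ?_⟩ <;> simp [h0]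

lemma isTypeIII_of_beta_pos {σ : Measure ℝ≥0} [IsFiniteMeasure σ] {R : ℝ≥0}
    (hR : σ (Set.Iic R)ᶜ = 0)
    (hσ : ∀ n, ∫ x : ℝ≥0, (x : ℝ) ^ n ∂σ = l.moment n * l.beta n) (hβ : ∀ n, 0 < l.beta n) :
    IsTypeIII l := by
  have ht := isScalarTriplet_restrict_compl_one hR hσ
  refine ⟨_, _, _, ht, ?_⟩
  by_contra! hcon
  obtain ⟨hs, hc⟩ := hcon
  -- if `c = 0` and `ν` is carried by `{0}`, then `l.moment 1 * l.beta 1 = ∫ x ∂ν` vanishes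
  have h1 := ht.moment_mul_beta 1
  have h2 : ∫ x : ℝ≥0, (x : ℝ) ^ 1 ∂(σ.restrict {1}ᶜ) = 0 := by
    refine integral_eq_zero_of_ae ?_
    filter_upwards [Measure.support_mem_ae (μ := σ.restrict {1}ᶜ)] with x hx
    have hx0 : x = 0 := hs hx
    simp [hx0]
  rw [h2, hc, mul_zero, add_zero] at h1
  exact (mul_pos (l.moment_pos 1) (hβ 1)).ne' h1

end Triplet

/-! ### Normality of multiplication by `z` on `L²(ρ)` -/

section Normal

variable {ρ : Measure ℂ}

lemma memLp_conj (hρ : IsCompact ρ.support) : MemLp (fun z : ℂ => starRingEnd ℂ z) ∞ ρ :=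
  (memLp_id hρ).star

/-- Multiplication by the conjugate variable on `L²(ρ)`. -/
def mulConj (hρ : IsCompact ρ.support) : Lp ℂ 2 ρ →L[ℂ] Lp ℂ 2 ρ :=
  (ContinuousLinearMap.mul ℂ ℂ).holderL ρ ∞ 2 2 ((memLp_conj hρ).toLp)

lemma mulConj_ae (hρ : IsCompact ρ.support) (f : Lp ℂ 2 ρ) :
    mulConj hρ f =ᵐ[ρ] fun z => starRingEnd ℂ z * f z := by
  filter_upwards [(ContinuousLinearMap.mul ℂ ℂ).coeFn_holder (r := 2) ((memLp_conj hρ).toLp) f,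
    (memLp_conj hρ).coeFn_toLp] with z h1 h2
  rw [h2] at h1
  simpa [mulConj] using h1

lemma adjoint_mulZ (hρ : IsCompact ρ.support) :
    ContinuousLinearMap.adjoint (mulZ hρ) = mulConj hρ := by
  refine ((ContinuousLinearMap.eq_adjoint_iff _ _).2 fun f g => ?_).symm
  rw [L2.inner_def, L2.inner_def]
  refine integral_congr_ae ?_
  filter_upwards [mulZ_ae hρ g, mulConj_ae hρ f] with z h1 h2
  rw [h1, h2, RCLike.inner_apply, RCLike.inner_apply, map_mul, Complex.conj_conj]
  ring

lemma isStarNormal_mulZ (hρ : IsCompact ρ.support) : IsStarNormal (mulZ hρ) := by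
  refine ⟨?_⟩
  rw [ContinuousLinearMap.star_eq_adjoint, adjoint_mulZ]
  ext1 f
  refine Lp.ext ?_
  rw [mul_apply_eq_comp, mul_apply_eq_comp]
  filter_upwards [mulZ_ae hρ f, mulConj_ae hρ f, mulZ_ae hρ (mulConj hρ f),
    mulConj_ae hρ (mulZ hρ f)] with z h1 h2 h3 h4
  rw [h3, h4, h1, h2]
  ring

lemma isSubnormal_of_unitarilyEquivalent_Mz (hρ : IsCompact ρ.support) {T : Ell2 →L[ℂ] Ell2}
    (U : H2 ρ ≃ₗᵢ[ℂ] Ell2) (hU : ∀ h, U (Mz hρ h) = T (U h)) : IsSubnormal T := by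
  refine ⟨Lp ℂ 2 ρ, inferInstance, inferInstance, inferInstance,
    (H2 ρ).subtypeₗᵢ.comp U.symm.toLinearIsometry, mulZ hρ, isStarNormal_mulZ hρ, fun h => ?_⟩
  have h1 : U.symm (T h) = Mz hρ (U.symm h) := by
    rw [LinearIsometryEquiv.symm_apply_eq, hU, U.apply_symm_apply]
  change ((U.symm (T h) : H2 ρ) : Lp ℂ 2 ρ) = mulZ hρ (U.symm h : H2 ρ)
  rw [h1]
  rfl

end Normal

/-! ### The Berger measure and the intertwining operator -/

section Berger

lemma radialMeasure_rotationMeasure (σ : Measure ℝ≥0) :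
    radialMeasure (rotationMeasure σ) = (σ Set.univ)⁻¹ • σ := by
  have h := congrArg (fun μ : Measure ℝ≥0 => μ Set.univ) (rotationMeasure_map_sq σ)
  simp only [Measure.map_apply (show Measurable fun z : ℂ => ‖z‖₊ ^ 2 by fun_prop)
    MeasurableSet.univ, Set.preimage_univ] at h
  rw [radialMeasure, rotationMeasure_map_sq, h]

/-- If no monomial vanishes in `H²` of the rotation-invariant measure, then multiplication by `z` is
a weighted shift in the orthogonal basis of monomials. -/
lemma exists_shift_unitarilyEquivalent_Mz {σ : Measure ℝ≥0} [IsFiniteMeasure σ] (hσ0 : σ ≠ 0)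
    {R : ℝ≥0} (hR : σ (Set.Iic R)ᶜ = 0)
    (hpos : ∀ n, 0 < ∫ x : ℝ≥0, (x : ℝ) ^ n ∂σ) :
    ∃ ω : Weights, IsSubnormalWithBerger ω (radialMeasure (rotationMeasure σ)) ∧
      UnitarilyEquivalent (Mz (isCompact_support_rotationMeasure hR)) ω.shift := by
  set hρ := isCompact_support_rotationMeasure hR
  have hnorm : ∀ n, ‖monoZ hρ n‖ ^ 2 = ∫ x : ℝ≥0, (x : ℝ) ^ n ∂σ := fun n => by
    rw [norm_monoZ_sq, rotationMeasure_map_sq]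
  obtain ⟨ω, U, hU, hω⟩ := exists_weightedShift (v := monoZ hρ)
    (fun m n hmn => inner_monoZ_of_ne hρ (rotationMeasure_map_mul σ) hmn)
    (fun n h => by
      have := hpos n
      rw [← hnorm, h, norm_zero] at this
      norm_num at this)
    (dense_span_monoZ hρ) (Mz_monoZ hρ)
  refine ⟨ω, ⟨isSubnormal_of_unitarilyEquivalent_Mz hρ U hU, ?_, ?_, fun n => ?_⟩, U, hU⟩
  · rw [radialMeasure_rotationMeasure]
    have : NeZero σ := ⟨hσ0⟩
    infer_instance
  · rw [radialMeasure_rotationMeasure]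
    exact isCompact_support_of_compl_Iic (R := R) (by
      rw [Measure.smul_apply, hR, smul_zero])
  · rw [hω, hnorm, hnorm, radialMeasure_rotationMeasure, integral_smul_measure, smul_eq_mul,
      ENNReal.toReal_inv, div_eq_inv_mul]
    simp [Measure.real]

/-- The normalised monomials `z ^ n / √(l.moment n)` are the images of the standard basis under an
operator that intertwines `l.shift` with `M_z` and has dense range. -/
lemma exists_intertwiner {l : Weights} {σ : Measure ℝ≥0} [IsFiniteMeasure σ] {R : ℝ≥0}
    (hR : σ (Set.Iic R)ᶜ = 0)
    (hσ : ∀ n, ∫ x : ℝ≥0, (x : ℝ) ^ n ∂σ = l.moment n * l.beta n) :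
    ∃ X : Ell2 →L[ℂ] H2 (rotationMeasure σ), DenseRange X ∧
      X ∘L l.shift = Mz (isCompact_support_rotationMeasure hR) ∘L X ∧
      ContinuousLinearMap.adjoint X ∘L X = bscr 2 l.shift := by
  set hρ := isCompact_support_rotationMeasure hR
  set v : ℕ → H2 (rotationMeasure σ) :=
    fun n => (((Real.sqrt (l.moment n))⁻¹ : ℝ) : ℂ) • monoZ hρ n with hv
  have hs : ∀ n, 0 < Real.sqrt (l.moment n) := fun n => Real.sqrt_pos.2 (l.moment_pos n)
  have horth : Pairwise fun m n => inner ℂ (v m) (v n) = 0 :=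
    pairwise_inner_smul_eq_zero
      (fun m n hmn => inner_monoZ_of_ne hρ (rotationMeasure_map_mul σ) hmn) _
  have hnorm : ∀ n, ‖v n‖ ^ 2 = l.beta n := fun n => by
    rw [hv, norm_smul, mul_pow, norm_monoZ_sq, rotationMeasure_map_sq, hσ, Complex.norm_real,
      norm_inv, Real.norm_of_nonneg (hs n).le, inv_pow, Real.sq_sqrt (l.moment_pos n).le,
      inv_mul_cancel_left₀ (l.moment_pos n).ne']
  obtain ⟨C, -, hC⟩ := l.exists_bound
  have hbound : ∀ n, ‖v n‖ ≤ Real.sqrt (1 + C ^ 2 * C ^ 2) := fun n => by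
    refine Real.le_sqrt_of_sq_le ?_
    have h1 : l.w n ^ 2 ≤ C ^ 2 := pow_le_pow_left₀ (l.pos n).le (hC n) 2
    have h2 : l.w (n + 1) ^ 2 ≤ C ^ 2 := pow_le_pow_left₀ (l.pos _).le (hC _) 2
    have h3 := mul_le_mul h1 h2 (by positivity) (by positivity)
    rw [hnorm, Weights.beta]
    nlinarith [sq_nonneg (l.w n)]
  obtain ⟨X, hX⟩ := exists_clm_of_orthogonal horth hbound
  refine ⟨X, ?_, clm_ext_e fun n => ?_, adjoint_comp_self_eq_bscr ?_ ?_⟩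
  · have hle : Submodule.span ℂ (Set.range (monoZ hρ)) ≤ LinearMap.range (X : Ell2 →ₗ[ℂ] _) := by
      rw [Submodule.span_le]
      rintro _ ⟨n, rfl⟩
      refine ⟨((Real.sqrt (l.moment n) : ℝ) : ℂ) • e n, ?_⟩
      rw [map_smul]
      change _ • X (e n) = _
      rw [hX, hv, smul_smul, ← Complex.ofReal_mul, mul_inv_cancel₀ (hs n).ne', Complex.ofReal_one,
        one_smul]
    have hdense := Submodule.dense_iff_topologicalClosure_eq_top.2 (dense_span_monoZ hρ)
    exact hdense.mono hle
  · rw [ContinuousLinearMap.comp_apply, ContinuousLinearMap.comp_apply, Weights.shift_e, map_smul,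
      hX, hX, hv, map_smul, Mz_monoZ, smul_smul, ← Complex.ofReal_mul, Weights.moment_succ,
      Real.sqrt_mul (l.moment_pos n).le, Real.sqrt_sq (l.pos n).le, mul_inv, mul_left_comm,
      mul_inv_cancel₀ (l.pos n).ne', mul_one]
  · simpa only [hX] using horth
  · simpa only [hX] using hnorm

end Berger

end CPDShift
end

open CPDShift
theorem theorem1p2 (l : Weights) (hCPD : IsCPD l.shift) (hI : ¬ IsTypeI l) :
    ∃ (ρ : Measure ℂ) (hρ : IsCompact ρ.support) (X : Ell2 →L[ℂ] H2 ρ),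
      ρ ≠ 0 ∧ IsFiniteMeasure ρ ∧ RotationInvariant ρ ∧ DenseRange X ∧
      X ∘L l.shift = Mz hρ ∘L X ∧
      ContinuousLinearMap.adjoint X ∘L X = bscr 2 l.shift ∧
      (QuasiInvertible X ↔ IsTypeIII l) ∧
      (IsTypeIII l → ∃ ω : Weights, IsSubnormalWithBerger ω (radialMeasure ρ) ∧
        UnitarilyEquivalent (Mz hρ) ω.shift) ∧
      (HasBoundedInverse X ↔
        ∃ ε : ℝ, 0 < ε ∧ (ε : ℂ) • ContinuousLinearMap.id ℂ Ell2 ≤ bscr 2 l.shift) ∧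
      (∀ ε : ℝ, 0 < ε →
        ((ε : ℂ) • ContinuousLinearMap.id ℂ Ell2 ≤ bscr 2 l.shift ↔ ∀ n, ε ≤ l.beta n)) ∧
      (HasBoundedInverse X → IsTypeIII l ∧
        ∃ ω : Weights, IsSubnormalWithBerger ω (radialMeasure ρ) ∧
          IsSimilar l.shift ω.shift) := by
  obtain ⟨σ, R, hfin, hR, hσ⟩ := exists_measure_moment_mul_beta hCPD
  have hσ0 : σ ≠ 0 := measure_ne_zero_of_not_isTypeI hI hR hσ
  obtain ⟨X, hdense, hXW, hXX⟩ := exists_intertwiner hR hσ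
  have hinj : Function.Injective X ↔ IsTypeIII l := by
    rw [injective_iff_beta_pos hXX]
    exact ⟨isTypeIII_of_beta_pos hR hσ, beta_pos_of_isTypeIII⟩
  have hshift : IsTypeIII l → ∃ ω : Weights,
      IsSubnormalWithBerger ω (radialMeasure (rotationMeasure σ)) ∧
        UnitarilyEquivalent (Mz (isCompact_support_rotationMeasure hR)) ω.shift := fun h =>
    exists_shift_unitarilyEquivalent_Mz hσ0 hR fun n => by
      rw [hσ]
      exact mul_pos (l.moment_pos n) (beta_pos_of_isTypeIII h n)
  refine ⟨rotationMeasure σ, isCompact_support_rotationMeasure hR, X, fun h0 => hσ0 ?_,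
    inferInstance, rotationInvariant_rotationMeasure σ, hdense, hXW, hXX,
    ⟨fun h => hinj.1 h.1, fun h => ⟨hinj.2 h, hdense⟩⟩, hshift, hasBoundedInverse_iff hXX hdense,
    fun ε _ => smul_id_le_bscr_two_iff l ε, ?_⟩
  · rw [← rotationMeasure_map_sq σ, h0, Measure.map_zero]
  · rintro ⟨Y, hYX, hXY⟩
    have hbij : Function.Bijective X :=
      ⟨Function.LeftInverse.injective (g := Y) fun h => congrArg (fun A : Ell2 →L[ℂ] Ell2 => A h) hYX,
        Function.RightInverse.surjective (g := Y) fun k => congrArg (fun A => A k) hXY⟩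
    have hIII := hinj.1 hbij.1
    obtain ⟨ω, hω, U, hU⟩ := hshift hIII
    refine ⟨hIII, ω, hω, (U.toContinuousLinearEquiv : H2 (rotationMeasure σ) →L[ℂ] Ell2) ∘L X,
      U.bijective.comp hbij, ?_⟩
    ext1 h
    change U (X (l.shift h)) = ω.shift (U (X h))
    rw [← hU]
    exact congrArg U (congrArg (fun A => A h) hXW)
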